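/- Let $N\ge 1$ and consider $N+1$ qubits: ports $A=A_1\cdots A_N$ and an input qubit $A_{N+1}$. For a set $a$ of qubits let $\vec S_a=\frac12\sum_{i\in a}(\sigma_x^{(i)},\sigma_y^{(i)},\sigma_z^{(i)})$, $S_a^2=\vec S_a\cdot\vec S_a$, $Z_a=\frac12\sum_{i\in a}\sigma^{(i)}_z$, and let $\mathbb I(j)_a$ be the orthogonal projector onto the eigenspace of $S_a^2$ with eigenvalue $j(j+1)$ (total spin $j$). Put $$h(N)=\tfrac{6}{(N+1)(N+2)(N+3)},\quad g^{[n]}(j)=\tfrac{(2j+1)\,n!}{(\frac n2-j)!\,(\frac n2+1+j)!},\quad \nu(j)=\tfrac{2^Nh(N)(2j+1)}{g^{[N]}(j)},\quad u(s)=\tfrac{2^{N+1}h(N)(2s+1)}{N\,g^{[N-1]}(s)},$$ where $j$ runs over $\{\frac N2,\frac N2-1,\dots\}\cap[0,\infty)$ and $s$ over $\{\frac{N-1}2,\frac{N-1}2-1,\dots\}\cap[0,\infty)$, and let $O_A=\sum_j\sqrt{\nu(j)}\,\mathbb I(j)_A$ (which is invertible), $\tilde\Theta_{i}=\sum_s u(s)\,\mathbb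 I(s)_{\bar A_i}$ with $\bar A_i=A\setminus A_i$. With $|\psi^-\rangle=(|01\rangle-|10\rangle)/\sqrt2$, the optimal POVM of probabilistic port-based teleportation with optimised resource state is $$\Pi_i=(O_A^{-1}\otimes I_{A_{N+1}})\big(|\psi^-\rangle\langle\psi^-|_{A_iA_{N+1}}\otimes\tilde\Theta_{i}\big)(O_A^{-1}\otimes I_{A_{N+1}})\ (1\le i\le N),\qquad \Pi_{N+1}=I-\sum_{i=1}^N\Pi_i .$$ Let $|k,j,s,m\rangle$ be the Schur states of the $N+1$ qubits, obtained by coupling the qubits $A_1,A_2,\dots,A_{N+1}$ one after the other with the Clebsch–Gordan coefficients (Condon–Shortley convention, $|0\rangle=|m=\frac12\rangle$, $|1\rangle=|m=-\frac12\rangle$): $k=(\tilde k,k_{N-2})$ lists the total spins of the initial segments of at most $N-1$ qubits, $k_{N-2}$ being that of $A_1\cdots A_{N-1}$ (it is $0$ if $N=1$ and $\frac12$ if $N=2$), $j$ is the spin of $A$, $s$ that of all $N+1$ qubits, consecutive spins are non-negative and differ by $\frac12$, and $m\in\{-s,\dots,s\}$ is the total $Z$-spin. Put $$\gamma(s)=\sqrt{\tfrac{s}{(2s+1)\,\nu(s-\frac12)}}\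 \ (\gamma(0)=0),\qquad \delta(s)=-\sqrt{\tfrac{s+1}{(2s+1)\,\nu(s+\frac12)}},\qquad \lambda(j,s)=\begin{cases}2^{-N}(\frac N2-j)& s=j+\frac12,\\ 2^{-N}(\frac N2+j+1)& s=j-\frac12.\end{cases}$$ Then the Schur states form an orthonormal basis of simultaneous eigenvectors of $S^2_{A_1\cdots A_i}$ ($1\le i\le N+1$) and $Z_{A_1\cdots A_{N+1}}$, with the eigenvalues indicated by their labels, and the following hold. 1. $\Pi_N$ has the following eigenvectors, which together span the space: every $|k,j,s,m\rangle$ with $k_{N-2}\ne s$, with eigenvalue $0$; and for all $\tilde k,m$ and all $s>0$ with $k_{N-2}=s$, $$\tfrac{\delta(s)|\tilde k,s,s-\frac12,s,m\rangle-\gamma(s)|\tilde k,s,s+\frac12,s,m\rangle}{\sqrt{\gamma(s)^2+\delta(s)^2}}\text{ with eigenvalue }0,\qquad \tfrac{\gamma(s)|\tilde k,s,s-\frac12,s,m\rangle+\delta(s)|\tilde k,s,s+\frac12,s,m\rangle}{\sqrt{\gamma(s)^2+\delta(s)^2}}\text{ with eigenvalue }u(s)\big(\gamma(s)^2+\delta(s)^2\big)>0;$$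 for $k_{N-2}=s=0$, where only $j=\frac12$ is possible, $|\tilde k,0,\frac12,0,0\rangle$ has eigenvalue $u(0)(\gamma(0)^2+\delta(0)^2)>0$. 2. For $1\le i\le N$, $\Pi_i=\mathrm{SWAP}_{A_iA_N}\,\Pi_N\,\mathrm{SWAP}_{A_iA_N}$, so $v$ is an eigenvector of $\Pi_N$ exactly when $\mathrm{SWAP}_{A_iA_N}v$ is an eigenvector of $\Pi_i$ with the same eigenvalue. 3. $\Pi_{N+1}$ is diagonal in the Schur basis: $|k,j,s,m\rangle$ has eigenvalue $1-\dfrac{2^{N-1}\lambda(j,s)\,u(s)}{\nu(j)}$ if $s\le\frac{N-1}2$, and eigenvalue $1$ if $s=\frac{N+1}2$ (where $\lambda(j,s)=0$ and $u(s)$ is not defined). -/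

import Mathlib

noncomputable section

namespace PBT

/-! ### Qubits, angular momentum, total spin

Half-integers (spins and `Z`-spins) are stored as their doubles throughout: the natural number `d`
stands for the spin `d / 2`, the integer `z` for the `Z`-spin `z / 2`. -/

/-- The Hilbert space of `n` qubits, with computational basis the bit strings `Fin n → Fin 2`. -/
abbrev QState (n : ℕ) : Type := EuclideanSpace ℂ (Fin n → Fin 2)

/-- Linear operators on `n` qubits. -/
abbrev QOp (n : ℕ) : Type := Module.End ℂ (QState n)

/-- The `2 × 2` matrix `M` acting on qubit `i`, identity on the other qubits. -/
def qubitOp {n : ℕ} (M : Matrix (Fin 2) (Fin 2) ℂ) (i : Fin n) : QOp n :=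
  Matrix.toEuclideanLin
    (Matrix.of fun x y : Fin n → Fin 2 => if ∀ l, l ≠ i → x l = y l then M (x i) (y i) else 0)

/-- The Pauli matrices `σ_x, σ_y, σ_z`. -/
def pauli : Fin 3 → Matrix (Fin 2) (Fin 2) ℂ :=
  ![!![0, 1; 1, 0], !![0, -Complex.I; Complex.I, 0], !![1, 0; 0, -1]]

/-- The component along the axis `c` of the angular momentum of the qubits in `a`. -/
def spinOp {n : ℕ} (a : Finset (Fin n)) (c : Fin 3) : QOp n :=
  ∑ i ∈ a, (1 / 2 : ℂ) • qubitOp (pauli c) i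

/-- The total angular momentum operator `S²_a`. -/
def totalSpin {n : ℕ} (a : Finset (Fin n)) : QOp n := ∑ c : Fin 3, spinOp a c * spinOp a c

/-- The `Z`-angular momentum operator `Z_a`. -/
def zSpin {n : ℕ} (a : Finset (Fin n)) : QOp n := spinOp a 2

/-- The projector `𝕀(j)_a`, `j = d / 2`, as an operator on all `n` qubits: the orthogonal projector
onto the states in which the qubits in `a` have total spin `j`, that is, onto the eigenspace of
`S²_a` for the eigenvalue `j (j + 1)`. -/
def spinProj {n : ℕ} (a : Finset (Fin n)) (d : ℕ) : QOp n :=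
  ((Module.End.eigenspace (totalSpin a)
    ((d : ℂ) / 2 * ((d : ℂ) / 2 + 1))).starProjection : QState n →ₗ[ℂ] QState n)

/-- The (doubled) total spins possible for `n` qubits: `n, n - 2, …` down to `0` or `1`. -/
def spins (n : ℕ) : Finset ℕ := (Finset.range (n + 1)).filter fun d => d % 2 = n % 2

/-! ### Schur states -/

/-- Labels of the Schur states on `n` qubits: `spin i` is twice the total spin of the first `i`
qubits (so `0` for `i = 0`, hence `1` for `i = 1`), consecutive spins differing by `1/2`, and `z` is
twice the total `Z`-spin `m ∈ {-j, -j + 1, …, j}`, where `j` is the spin of all the qubits. -/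
structure SchurLabel (n : ℕ) where
  spin : Fin (n + 1) → ℕ
  spin_zero : spin 0 = 0
  spin_step : ∀ i : Fin n,
    spin i.succ = spin i.castSucc + 1 ∨ spin i.castSucc = spin i.succ + 1
  z : ℤ
  abs_z_le : |z| ≤ (spin (Fin.last n) : ℤ)
  even_z : Even (z + (spin (Fin.last n) : ℤ))

/-- Twice the `Z`-spin of a computational basis state of a qubit: `|0⟩ = |1/2⟩`, `|1⟩ = |-1/2⟩`. -/
def zBit (b : Fin 2) : ℤ := if b = 0 then 1 else -1

/-- The Clebsch-Gordan coefficient `C^{J, M}_{j, M - x; 1/2, x}` in the Condon-Shortley convention,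
where `d, D, z` are twice `j, J, M` and the bit `b` encodes `x = ± 1/2`. -/
def cgHalf (d D : ℕ) (z : ℤ) (b : Fin 2) : ℝ :=
  if D = d + 1 then
    if b = 0 then √(1 / 2 * (1 + (z : ℝ) / ((d : ℝ) + 1)))
    else √(1 / 2 * (1 - (z : ℝ) / ((d : ℝ) + 1)))
  else if d = D + 1 then
    if b = 0 then -√(1 / 2 * (1 - (z : ℝ) / ((d : ℝ) + 1)))
    else √(1 / 2 * (1 + (z : ℝ) / ((d : ℝ) + 1)))
  else 0

/-- The Schur state with label `ℓ`, obtained by coupling the qubits one after the other: the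
amplitude at `|x₁ … xₙ⟩` is the product of the coefficients
`C^{k_i, x₁ + ⋯ + x_i}_{k_{i-1}, x₁ + ⋯ + x_{i-1}; 1/2, x_i}`, with `k_i` the spin of the first `i`
qubits, if `x₁ + ⋯ + xₙ = m`, and `0` otherwise. (The factor at the first `i` at which
`|x₁ + ⋯ + x_i| ≤ k_i` fails, if there is one, is `0`.) -/
def schurState {n : ℕ} (ℓ : SchurLabel n) : QState n :=
  WithLp.toLp 2 fun x : Fin n → Fin 2 =>
    if ∑ l, zBit (x l) = ℓ.z then
      ((∏ i : Fin n, cgHalf (ℓ.spin i.castSucc) (ℓ.spin i.succ)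
        (∑ l ∈ Finset.Iic i, zBit (x l)) (x i) : ℝ) : ℂ)
    else 0

/-- For a Schur state on `N + 1` qubits, (twice) the spin of the first `N - 1` qubits. -/
def SchurLabel.kSpin {N : ℕ} (ℓ : SchurLabel (N + 1)) : ℕ := ℓ.spin ⟨N - 1, by omega⟩

/-- For a Schur state on `N + 1` qubits, (twice) the spin of the first `N` qubits. -/
def SchurLabel.jSpin {N : ℕ} (ℓ : SchurLabel (N + 1)) : ℕ := ℓ.spin ⟨N, by omega⟩

/-- For a Schur state on `N + 1` qubits, (twice) the spin of all the qubits. -/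
def SchurLabel.sSpin {N : ℕ} (ℓ : SchurLabel (N + 1)) : ℕ := ℓ.spin (Fin.last (N + 1))

/-! ### Coefficients -/

/-- `h(N) = 6 / ((N + 1) (N + 2) (N + 3))`. -/
def hCoef (N : ℕ) : ℝ := 6 / (((N : ℝ) + 1) * ((N : ℝ) + 2) * ((N : ℝ) + 3))

/-- `g^{[N]}(j) = (2j + 1) N! / ((N/2 - j)! (N/2 + 1 + j)!)`, with `d = 2j ≤ N`, `d ≡ N mod 2`. -/
def gCoef (N d : ℕ) : ℝ :=
  ((d : ℝ) + 1) * (N.factorial : ℝ) /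
    ((((N - d) / 2).factorial : ℝ) * (((N + d) / 2 + 1).factorial : ℝ))

/-- `ν(j) = 2^N h(N) (2j + 1) / g^{[N]}(j)`, with `d = 2j`. -/
def nu (N d : ℕ) : ℝ := 2 ^ N * hCoef N * ((d : ℝ) + 1) / gCoef N d

/-- `u(s) = 2^{N+1} h(N) (2s + 1) / (N g^{[N-1]}(s))`, with `d = 2s`. -/
def uCoef (N d : ℕ) : ℝ := 2 ^ (N + 1) * hCoef N * ((d : ℝ) + 1) / ((N : ℝ) * gCoef (N - 1) d)

/-- `λ(j, s)`, with `j` and `s` given by their doubles. -/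
def lam (N j s : ℕ) : ℝ :=
  if s = j + 1 then 1 / 2 ^ N * ((N : ℝ) / 2 - (j : ℝ) / 2)
  else if j = s + 1 then 1 / 2 ^ N * ((N : ℝ) / 2 + (j : ℝ) / 2 + 1)
  else 0

/-- `c(k, j, s)`, with `k`, `j` and `s` given by their doubles. -/
def cCoef (k j s : ℕ) : ℝ :=
  if s = j + 1 ∧ k = j + 1 then √((s : ℝ) / 2 / ((s : ℝ) + 1))
  else if j = s + 1 ∧ j = k + 1 then -√(((s : ℝ) / 2 + 1) / ((s : ℝ) + 1))
  else 0

/-- `γ(s) = c(s, s - 1/2, s) / √ν(s - 1/2)`, with `d = 2s`; it is `0` for `s = 0`. -/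
def gam (N d : ℕ) : ℝ := cCoef d (d - 1) d / √(nu N (d - 1))

/-- `δ(s) = c(s, s + 1/2, s) / √ν(s + 1/2)`, with `d = 2s`. -/
def del (N d : ℕ) : ℝ := cCoef d (d + 1) d / √(nu N (d + 1))

/-! ### The measurement

Alice holds `N + 1` qubits: the ports `A_1, …, A_N` (indices `i.castSucc`, `i : Fin N`) and the
input `A_{N+1}` (index `Fin.last N`). -/

/-- Amplitudes of the singlet `(|01⟩ - |10⟩) / √2`. -/
def singlet (b b' : Fin 2) : ℂ :=
  if b = 0 ∧ b' = 1 then 1 / (√2 : ℝ) else if b = 1 ∧ b' = 0 then -1 / (√2 : ℝ) else 0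

/-- The projector onto the singlet of the qubits `p` and `q`, identity on the other qubits. -/
def singletProj {n : ℕ} (p q : Fin n) : QOp n :=
  Matrix.toEuclideanLin
    (Matrix.of fun x y : Fin n → Fin 2 =>
      if ∀ l, l ≠ p → l ≠ q → x l = y l then
        singlet (x p) (x q) * (starRingEnd ℂ) (singlet (y p) (y q))
      else 0)

/-- The operator exchanging the qubits `p` and `q`. -/
def swapOp {n : ℕ} (p q : Fin n) : QOp n :=
  Matrix.toEuclideanLin
    (Matrix.of fun x y : Fin n → Fin 2 => if y = x ∘ Equiv.swap p q then (1 : ℂ) else 0)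

/-- The ports `A = A_1 … A_N`. -/
def ports (N : ℕ) : Finset (Fin (N + 1)) := Finset.univ.erase (Fin.last N)

/-- `O_A ⊗ I = ∑_j √ν(j) 𝕀(j)_A ⊗ I`. -/
def opO (N : ℕ) : QOp (N + 1) :=
  ∑ d ∈ spins N, ((√(nu N d) : ℝ) : ℂ) • spinProj (ports N) d

/-- `Θ̃_i = ∑_s u(s) 𝕀(s)` on the ports other than `A_i`, identity on the other two qubits. -/
def opTheta (N : ℕ) (i : Fin N) : QOp (N + 1) :=
  ∑ d ∈ spins (N - 1), ((uCoef N d : ℝ) : ℂ) • spinProj ((ports N).erase i.castSucc) d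

/-- The measurement operator `Π_i` for the success outcome `i`. The tensor product of the singlet
projector and `Θ̃_i`, which act on complementary sets of qubits, is their composition. -/
def povm (N : ℕ) (i : Fin N) : QOp (N + 1) :=
  Ring.inverse (opO N) * (singletProj i.castSucc (Fin.last N) * opTheta N i) *
    Ring.inverse (opO N)

/-- The measurement operator `Π_{N+1}` for failure. -/
def povmFail (N : ℕ) : QOp (N + 1) := 1 - ∑ i : Fin N, povm N i

end PBT

end

open PBT

noncomputable section

namespace PBT

/-! ### Action of the operators on amplitudes -/

/-! In the Schur basis every factor of the measurement is either diagonal or a rank-one block. The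
basis itself is built by recursion on the number of qubits: `schurVec` is determined by its two
slices along the last qubit, each a Clebsch–Gordan coefficient times a shorter `schurVec`. Facts
about the basis thus reduce to identities between a few square roots. The ladder identities for
`cgHalf` give the action of the raising and lowering operators (`spinRaise_schurVec`,
`spinLower_schurVec`), hence the eigenvalues of the total spins. The Clebsch–Gordan coefficients
form an orthogonal `2 × 2` matrix, whose rows give orthonormality (`inner_schurVec`) and whose
columns give completeness (`span_schurVecs`).

For `Π_N`, the operators `O_A` and `Θ̃_N` are functions of the spins of two initial segments, so
they are diagonal. The singlet of the last two qubits has spin zero: it is seen only by states with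
`k = s`, and on the block `j = s ∓ 1/2` its projector is the outer product of the vector of the two
coefficients `c(s, j, s)` with itself (`singletProj_schurVec_pair`). Dividing by `√ν(j)` on both
sides turns that vector into `(γ, δ)`, so `Π_N` acts on the block as `u(s)` times the outer product
of `(γ, δ)` with itself. Its eigenvectors are `(γ, δ)` and the orthogonal vector `(δ, -γ)`. The
other `Π_i` follow because exchanging two ports preserves `O_A` and permutes the remaining data
(`swapOp_conj_povm`).

For the failure outcome, a singlet on `A_i A_{N+1}` forces the spin of the other ports to equal the
total spin, so in the product with the singlet projector `Θ̃_i` may be replaced by one function of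
the total spin, the same for all `i` (`singletProj_mul_opTheta`). What remains is the sum of the
singlet projectors, which by `sum_singletProj` is an affine function of the total spins of all the
qubits and of the ports, hence diagonal. -/

theorem toEuclideanLin_apply_eq_sum {ι : Type*} [Fintype ι] [DecidableEq ι] (A : Matrix ι ι ℂ)
    (v : EuclideanSpace ℂ ι) (x : ι) : Matrix.toEuclideanLin A v x = ∑ y, A x y * v y :=
  rfl

/-- Among all bit strings, only those agreeing with `x` away from qubit `i` contribute to the matrix
product. -/
theorem qubitOp_apply {n : ℕ} (M : Matrix (Fin 2) (Fin 2) ℂ) (i : Fin n) (v : QState n)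
    (x : Fin n → Fin 2) :
    qubitOp M i v x = ∑ b, M (x i) b * v (Function.update x i b) := by
  rw [qubitOp, toEuclideanLin_apply_eq_sum]
  symm
  refine Finset.sum_of_injOn (fun b => Function.update x i b) ?_ (by simp) ?_ ?_
  · exact (Function.update_injective x i).injOn
  · intro y _ hy
    rw [Matrix.of_apply, if_neg, zero_mul]
    intro h
    refine hy ⟨y i, by simp, ?_⟩
    funext l
    by_cases hl : l = i
    · subst hl; simp
    · simp [hl, h l hl]
  · intro b _
    have : ∀ l, l ≠ i → x l = Function.update x i b l := fun l hl => by simp [hl]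
    rw [Matrix.of_apply, if_pos this, Function.update_self]

theorem singletProj_apply {n : ℕ} {p q : Fin n} (hpq : p ≠ q) (v : QState n)
    (x : Fin n → Fin 2) :
    singletProj p q v x = singlet (x p) (x q) *
      (((√2 : ℝ) : ℂ)⁻¹ * (v (Function.update (Function.update x p 0) q 1) -
        v (Function.update (Function.update x p 1) q 0))) := by
  have key : singletProj p q v x = ∑ b : Fin 2 × Fin 2, singlet (x p) (x q) *
      (starRingEnd ℂ) (singlet b.1 b.2) *
        v (Function.update (Function.update x p b.1) q b.2) := by
    rw [singletProj, toEuclideanLin_apply_eq_sum]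
    symm
    refine Finset.sum_of_injOn
      (fun b : Fin 2 × Fin 2 => Function.update (Function.update x p b.1) q b.2) ?_ (by simp) ?_ ?_
    · rintro ⟨a, b⟩ _ ⟨a', b'⟩ _ h
      have h1 := congrFun h p
      have h2 := congrFun h q
      simp [hpq] at h1 h2
      simp [h1, h2]
    · intro y _ hy
      rw [Matrix.of_apply, if_neg, zero_mul]
      intro h
      refine hy ⟨(y p, y q), by simp, ?_⟩
      funext l
      by_cases hq : l = q
      · subst hq; simp
      · by_cases hp : l = p
        · subst hp; simp [hq]
        · simp [hq, hp, h l hp hq]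
    · rintro ⟨b, b'⟩ _
      have : ∀ l, l ≠ p → l ≠ q →
          x l = Function.update (Function.update x p b) q b' l := fun l h1 h2 => by simp [h1, h2]
      simp only [Matrix.of_apply]
      rw [if_pos this]
      simp [hpq]
  rw [key, Fintype.sum_prod_type]
  simp [Fin.sum_univ_two, singlet]
  ring_nf

theorem swapOp_apply {n : ℕ} (p q : Fin n) (v : QState n) (x : Fin n → Fin 2) :
    swapOp p q v x = v (x ∘ Equiv.swap p q) := by
  rw [swapOp, toEuclideanLin_apply_eq_sum]
  simp

theorem swapOp_mul_self {n : ℕ} (p q : Fin n) : swapOp p q * swapOp p q = 1 := by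
  ext v x
  have : (x ∘ Equiv.swap p q) ∘ Equiv.swap p q = x := by funext l; simp
  simp only [Module.End.mul_apply, swapOp_apply, Module.End.one_apply, this]

theorem swapOp_swapOp {n : ℕ} (p q : Fin n) (v : QState n) :
    swapOp p q (swapOp p q v) = v := by
  rw [← Module.End.mul_apply, swapOp_mul_self, Module.End.one_apply]

/-- The exchange of two qubits as a unitary. -/
def swapIso {n : ℕ} (p q : Fin n) : QState n ≃ₗᵢ[ℂ] QState n :=
  LinearIsometryEquiv.piLpCongrLeft 2 ℂ ℂ (Equiv.arrowCongr (Equiv.swap p q) (Equiv.refl (Fin 2)))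

theorem swapIso_apply {n : ℕ} (p q : Fin n) (v : QState n) : swapIso p q v = swapOp p q v := by
  ext x
  rw [swapOp_apply, swapIso, LinearIsometryEquiv.piLpCongrLeft_apply]
  simp [Equiv.piCongrLeft']
  rfl

theorem swapIso_symm_apply {n : ℕ} (p q : Fin n) (v : QState n) :
    (swapIso p q).symm v = swapOp p q v := by
  rw [LinearIsometryEquiv.symm_apply_eq, swapIso_apply, swapOp_swapOp]

theorem swapOp_mul_qubitOp {n : ℕ} (p q i : Fin n) (M : Matrix (Fin 2) (Fin 2) ℂ) :
    swapOp p q * qubitOp M i = qubitOp M (Equiv.swap p q i) * swapOp p q := by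
  ext v x
  simp only [Module.End.mul_apply, swapOp_apply, qubitOp_apply, Function.update_comp_equiv,
    Function.comp_apply, Equiv.symm_swap, Equiv.swap_apply_self]

theorem swapOp_mul_spinOp {n : ℕ} (p q : Fin n) (a : Finset (Fin n)) (c : Fin 3) :
    swapOp p q * spinOp a c = spinOp (a.map (Equiv.swap p q).toEmbedding) c * swapOp p q := by
  simp [spinOp, Finset.mul_sum, Finset.sum_mul, swapOp_mul_qubitOp]

theorem swapOp_mul_totalSpin {n : ℕ} (p q : Fin n) (a : Finset (Fin n)) :
    swapOp p q * totalSpin a = totalSpin (a.map (Equiv.swap p q).toEmbedding) * swapOp p q := by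
  simp only [totalSpin, Finset.mul_sum, Finset.sum_mul]
  refine Finset.sum_congr rfl fun c _ => ?_
  rw [← mul_assoc, swapOp_mul_spinOp, mul_assoc, swapOp_mul_spinOp, mul_assoc]

/-- The exchange is a unitary that intertwines the two total spin operators, so it carries
eigenspace to eigenspace and orthogonal projection to orthogonal projection. -/
theorem spinProj_map_swap {n : ℕ} (p q : Fin n) (a : Finset (Fin n)) (d : ℕ) :
    spinProj (a.map (Equiv.swap p q).toEmbedding) d = swapOp p q * spinProj a d * swapOp p q := by
  have hmap : Module.End.eigenspace (totalSpin (a.map (Equiv.swap p q).toEmbedding))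
      ((d : ℂ) / 2 * ((d : ℂ) / 2 + 1)) =
      (Module.End.eigenspace (totalSpin a) ((d : ℂ) / 2 * ((d : ℂ) / 2 + 1))).map
        ((swapIso p q).toLinearEquiv : QState n →ₗ[ℂ] QState n) := by
    ext v
    have h := LinearMap.congr_fun (swapOp_mul_totalSpin p q a) (swapOp p q v)
    simp only [Module.End.mul_apply, swapOp_swapOp] at h
    rw [Submodule.mem_map, Module.End.mem_eigenspace_iff, ← h]
    constructor
    · intro hv
      refine ⟨swapOp p q v, ?_, ?_⟩
      · rw [Module.End.mem_eigenspace_iff, ← map_smul, ← hv, swapOp_swapOp]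
      · exact (swapIso_apply p q _).trans (swapOp_swapOp p q v)
    · rintro ⟨w, hw, hwv⟩
      have hwv' : swapOp p q w = v := (swapIso_apply p q w).symm.trans hwv
      rw [Module.End.mem_eigenspace_iff] at hw
      rw [← hwv', swapOp_swapOp, hw, map_smul]
  ext1 v
  simp only [spinProj, Module.End.mul_apply, ContinuousLinearMap.coe_coe]
  simp only [hmap]
  rw [Submodule.starProjection_map_apply, swapIso_apply, swapIso_symm_apply]

theorem swapOp_conj_singletProj {n : ℕ} (p q r : Fin n) (hr : p ≠ r) (hq : q ≠ r) :
    singletProj p r = swapOp p q * singletProj q r * swapOp p q := by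
  ext v x
  simp only [Module.End.mul_apply, swapOp_apply, singletProj_apply hr, singletProj_apply hq,
    Function.update_comp_equiv, Function.comp_apply, Equiv.symm_swap, Equiv.swap_apply_right,
    Equiv.swap_apply_of_ne_of_ne hr.symm hq.symm]
  have : (x ∘ Equiv.swap p q) ∘ Equiv.swap p q = x := by funext l; simp
  simp only [this]

/-! ### Hermiticity and projectors -/

theorem pauli_isHermitian (c : Fin 3) : (pauli c).IsHermitian := by
  fin_cases c <;> ext i j <;> fin_cases i <;> fin_cases j <;> simp [pauli]

theorem qubitOp_isSymmetric {n : ℕ} {M : Matrix (Fin 2) (Fin 2) ℂ} (hM : M.IsHermitian)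
    (i : Fin n) : (qubitOp M i).IsSymmetric := by
  rw [qubitOp, Matrix.isSymmetric_toEuclideanLin_iff]
  ext x y
  have h := hM.apply (x i) (y i)
  simp only [Matrix.conjTranspose_apply, Matrix.of_apply]
  have : (∀ l, l ≠ i → y l = x l) ↔ (∀ l, l ≠ i → x l = y l) :=
    forall₂_congr fun _ _ => eq_comm
  simp only [this]
  split_ifs
  · exact h
  · simp

theorem isSymmetric_sum {ι E : Type*} [NormedAddCommGroup E] [InnerProductSpace ℂ E]
    (s : Finset ι) (T : ι → E →ₗ[ℂ] E) (h : ∀ i ∈ s, (T i).IsSymmetric) :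
    (∑ i ∈ s, T i).IsSymmetric := by
  classical
  induction s using Finset.induction_on with
  | empty => simp
  | insert a s ha ih =>
    rw [Finset.sum_insert ha]
    exact (h a (by simp)).add (ih fun i hi => h i (by simp [hi]))

theorem spinOp_isSymmetric {n : ℕ} (a : Finset (Fin n)) (c : Fin 3) :
    (spinOp a c).IsSymmetric :=
  isSymmetric_sum _ _ fun i _ =>
    (qubitOp_isSymmetric (pauli_isHermitian c) i).smul (by simp [Complex.conj_ofNat])

theorem totalSpin_isSymmetric {n : ℕ} (a : Finset (Fin n)) : (totalSpin a).IsSymmetric :=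
  isSymmetric_sum _ _ fun c _ =>
    (spinOp_isSymmetric a c).mul_of_commute (spinOp_isSymmetric a c) (Commute.refl _)

theorem spin_eigenvalue_injective {d e : ℕ}
    (h : (d : ℂ) / 2 * ((d : ℂ) / 2 + 1) = (e : ℂ) / 2 * ((e : ℂ) / 2 + 1)) : d = e := by
  have h' : ((d : ℂ) * (d + 2)) = e * (e + 2) := by linear_combination 4 * h
  have h'' : d * (d + 2) = e * (e + 2) := by exact_mod_cast h'
  rcases lt_trichotomy d e with hlt | heq | hgt
  · nlinarith
  · exact heq
  · nlinarith

/-- Distinct eigenspaces of a symmetric operator are orthogonal, and distinct spins have distinct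
eigenvalues. This evaluates the projectors on eigenvectors with no prior knowledge of the spectrum.
-/
theorem spinProj_apply_of_totalSpin {n : ℕ} {a : Finset (Fin n)} {e : ℕ} {v : QState n}
    (hv : totalSpin a v = ((e : ℂ) / 2 * ((e : ℂ) / 2 + 1)) • v) (d : ℕ) :
    spinProj a d v = if d = e then v else 0 := by
  rw [spinProj, ContinuousLinearMap.coe_coe]
  split_ifs with h
  · subst h
    rw [Submodule.starProjection_eq_self_iff, Module.End.mem_eigenspace_iff]
    exact hv
  · rw [Submodule.starProjection_apply_eq_zero_iff]
    intro w hw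
    have hne : (d : ℂ) / 2 * ((d : ℂ) / 2 + 1) ≠ (e : ℂ) / 2 * ((e : ℂ) / 2 + 1) :=
      fun h' => h (spin_eigenvalue_injective h')
    exact (totalSpin_isSymmetric a).orthogonalFamily_eigenspaces hne ⟨w, hw⟩
      ⟨v, Module.End.mem_eigenspace_iff.mpr hv⟩

theorem sum_smul_spinProj_apply {n : ℕ} {a : Finset (Fin n)} {e : ℕ} {v : QState n}
    (hv : totalSpin a v = ((e : ℂ) / 2 * ((e : ℂ) / 2 + 1)) • v) (D : Finset ℕ) (f : ℕ → ℂ) :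
    (∑ d ∈ D, f d • spinProj a d) v = if e ∈ D then f e • v else 0 := by
  simp [LinearMap.sum_apply, spinProj_apply_of_totalSpin hv]

/-! ### The singlet projector and the angular momenta -/

/-- The identity `|ψ⁻⟩⟨ψ⁻| = (1 - σ · σ) / 4`, checked on the four values of the two bits involved.
-/
theorem singletProj_eq {n : ℕ} {p q : Fin n} (hpq : p ≠ q) :
    singletProj p q = (1 / 4 : ℂ) • (1 : QOp n) -
      (1 / 4 : ℂ) • ∑ c, qubitOp (pauli c) p * qubitOp (pauli c) q := by
  ext v x
  have hs : ((√2 : ℝ) : ℂ)⁻¹ * ((√2 : ℝ) : ℂ)⁻¹ = 1 / 2 := by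
    rw [← mul_inv, ← Complex.ofReal_mul, Real.mul_self_sqrt (by norm_num)]; norm_num
  have hx : v x = v (Function.update (Function.update x p (x p)) q (x q)) := by simp
  rw [singletProj_apply hpq]
  simp only [LinearMap.sub_apply, LinearMap.smul_apply, Module.End.one_apply, LinearMap.add_apply,
    Fin.sum_univ_three, Module.End.mul_apply, PiLp.sub_apply, PiLp.smul_apply, PiLp.add_apply,
    qubitOp_apply, Fin.sum_univ_two, Function.update_of_ne hpq.symm, smul_eq_mul, hx]
  generalize x p = b
  generalize x q = b'
  fin_cases b <;> fin_cases b' <;>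
    simp [pauli, singlet, div_eq_mul_inv, ← mul_assoc, hs] <;> ring_nf

/-! ### The sum of the singlet projectors -/

theorem qubitOp_commute {n : ℕ} {p q : Fin n} (hpq : p ≠ q) (M M' : Matrix (Fin 2) (Fin 2) ℂ) :
    Commute (qubitOp M p) (qubitOp M' q) := by
  ext v x
  simp only [Module.End.mul_apply, qubitOp_apply, Fin.sum_univ_two, Function.update_of_ne hpq,
    Function.update_of_ne hpq.symm, Function.update_comm hpq]
  ring

theorem qubitOp_pauli_mul_self {n : ℕ} (c : Fin 3) (i : Fin n) :
    qubitOp (pauli c) i * qubitOp (pauli c) i = 1 := by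
  ext v x
  simp only [Module.End.mul_apply, qubitOp_apply, Fin.sum_univ_two, Function.update_self,
    Function.update_idem, Module.End.one_apply]
  have hx : v x = v (Function.update x i (x i)) := by simp
  rw [hx]
  generalize x i = b
  fin_cases c <;> fin_cases b <;> simp [pauli] <;> ring_nf <;> simp

theorem spinOp_ports (N : ℕ) (c : Fin 3) :
    spinOp (ports N) c = ∑ i : Fin N, (1 / 2 : ℂ) • qubitOp (pauli c) i.castSucc := by
  have h := Finset.sum_erase_add Finset.univ
    (fun i : Fin (N + 1) => (1 / 2 : ℂ) • qubitOp (pauli c) i) (Finset.mem_univ (Fin.last N))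
  rw [Fin.sum_univ_castSucc] at h
  exact add_right_cancel h

theorem spinOp_univ_succ (N : ℕ) (c : Fin 3) :
    spinOp (Finset.univ : Finset (Fin (N + 1))) c =
      spinOp (ports N) c + (1 / 2 : ℂ) • qubitOp (pauli c) (Fin.last N) := by
  rw [spinOp_ports, spinOp, Fin.sum_univ_castSucc]

/-- Expand the square of the total spin as ports plus last qubit: the cross terms are the `σ · σ`
couplings occurring in the singlet projectors, and the last qubit contributes `3/4`, whose half is
the constant `3/8`. -/
theorem sum_singletProj (N : ℕ) :
    ∑ i : Fin N, singletProj i.castSucc (Fin.last N) =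
      ((N : ℂ) / 4 + 3 / 8) • (1 : QOp (N + 1)) -
        (1 / 2 : ℂ) • (totalSpin Finset.univ - totalSpin (ports N)) := by
  have h1 : ∀ c : Fin 3, spinOp (Finset.univ : Finset (Fin (N + 1))) c * spinOp Finset.univ c =
      spinOp (ports N) c * spinOp (ports N) c + (1 / 4 : ℂ) • (1 : QOp (N + 1)) +
        (1 / 2 : ℂ) • ∑ i : Fin N, qubitOp (pauli c) i.castSucc * qubitOp (pauli c) (Fin.last N) := by
    intro c
    have hc : qubitOp (pauli c) (Fin.last N) * spinOp (ports N) c =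
        spinOp (ports N) c * qubitOp (pauli c) (Fin.last N) := by
      rw [spinOp_ports, Finset.mul_sum, Finset.sum_mul]
      refine Finset.sum_congr rfl fun i _ => ?_
      rw [mul_smul_comm, smul_mul_assoc,
        (qubitOp_commute (Fin.castSucc_lt_last i).ne (pauli c) (pauli c)).eq]
    have hs : ∑ i : Fin N, qubitOp (pauli c) i.castSucc * qubitOp (pauli c) (Fin.last N) =
        (2 : ℂ) • (spinOp (ports N) c * qubitOp (pauli c) (Fin.last N)) := by
      rw [spinOp_ports, Finset.sum_mul, Finset.smul_sum]
      refine Finset.sum_congr rfl fun i _ => ?_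
      rw [smul_mul_assoc, smul_smul]
      norm_num
    rw [spinOp_univ_succ, mul_add, add_mul, add_mul, hs, smul_mul_assoc, hc, mul_smul_comm,
      smul_mul_assoc, mul_smul_comm, qubitOp_pauli_mul_self]
    module
  have h2 : ∑ i : Fin N, singletProj i.castSucc (Fin.last N) =
      ((N : ℂ) / 4) • (1 : QOp (N + 1)) - (1 / 4 : ℂ) • ∑ c, ∑ i : Fin N,
        qubitOp (pauli c) i.castSucc * qubitOp (pauli c) (Fin.last N) := by
    rw [Finset.sum_comm, Finset.smul_sum]
    simp only [singletProj_eq (Fin.castSucc_lt_last _).ne]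
    rw [Finset.sum_sub_distrib, Finset.sum_const, Finset.card_univ, Fintype.card_fin,
      ← Nat.cast_smul_eq_nsmul ℂ, smul_smul]
    congr 2
    ring
  rw [h2]
  simp only [totalSpin, Fin.sum_univ_three, h1]
  module

/-! ### Slices along the last qubit -/

/-- The component of a state on which the last qubit is `b`. -/
def slice {n : ℕ} (b : Fin 2) : QState (n + 1) →ₗ[ℂ] QState n where
  toFun v := WithLp.toLp 2 fun x => v (Fin.snoc (α := fun _ => Fin 2) x b)
  map_add' _ _ := rfl
  map_smul' _ _ := rfl

theorem slice_apply {n : ℕ} (b : Fin 2) (v : QState (n + 1)) (x : Fin n → Fin 2) :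
    slice b v x = v (Fin.snoc (α := fun _ => Fin 2) x b) := rfl

theorem ext_slice {n : ℕ} {v w : QState (n + 1)} (h : ∀ b, slice b v = slice b w) : v = w := by
  ext x
  rw [← Fin.snoc_init_self x, ← slice_apply, ← slice_apply, h]

/-- The state `w ⊗ |b⟩`. -/
def attach {n : ℕ} (b : Fin 2) : QState n →ₗ[ℂ] QState (n + 1) where
  toFun w := WithLp.toLp 2 fun x => if x (Fin.last n) = b then w (Fin.init x) else 0
  map_add' v w := by ext x; simp [← ite_add_zero]
  map_smul' c v := by ext x; simp

theorem slice_attach {n : ℕ} (b b' : Fin 2) (w : QState n) :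
    slice b' (attach b w) = if b' = b then w else 0 := by
  ext x
  rw [slice_apply]
  simp only [attach, LinearMap.coe_mk, AddHom.coe_mk, Fin.snoc_last, Fin.init_snoc]
  split_ifs <;> rfl

theorem sum_attach_slice {n : ℕ} (v : QState (n + 1)) : ∑ b, attach b (slice b v) = v := by
  refine ext_slice fun b => ?_
  fin_cases b <;> simp [slice_attach]

theorem inner_eq_sum_slice {n : ℕ} (v w : QState (n + 1)) :
    inner ℂ v w = ∑ b, inner ℂ (slice b v) (slice b w) := by
  simp only [PiLp.inner_apply, slice_apply]
  rw [← Fintype.sum_prod_type', ← (Fin.snocEquiv fun _ => Fin 2).sum_comp]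
  rfl

theorem slice_qubitOp_castSucc {n : ℕ} (M : Matrix (Fin 2) (Fin 2) ℂ) (i : Fin n) (b : Fin 2)
    (v : QState (n + 1)) : slice b (qubitOp M i.castSucc v) = qubitOp M i (slice b v) := by
  ext x
  simp only [slice_apply, qubitOp_apply, Fin.snoc_castSucc, Fin.snoc_update]

theorem slice_qubitOp_last {n : ℕ} (M : Matrix (Fin 2) (Fin 2) ℂ) (b : Fin 2)
    (v : QState (n + 1)) :
    slice b (qubitOp M (Fin.last n) v) = ∑ b', M b b' • slice b' v := by
  ext x
  simp only [slice_apply, qubitOp_apply, Fin.snoc_last, Fin.update_snoc_last]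
  simp [slice_apply]

theorem slice_spinOp_univ {n : ℕ} (c : Fin 3) (b : Fin 2) (v : QState (n + 1)) :
    slice b (spinOp Finset.univ c v) =
      spinOp Finset.univ c (slice b v) + (1 / 2 : ℂ) • ∑ b', pauli c b b' • slice b' v := by
  rw [spinOp, Fin.sum_univ_castSucc, LinearMap.add_apply, map_add, LinearMap.smul_apply, map_smul,
    slice_qubitOp_last, LinearMap.sum_apply, map_sum, spinOp, LinearMap.sum_apply]
  simp only [LinearMap.smul_apply, map_smul, slice_qubitOp_castSucc]

/-- The bound `i ≤ n` keeps the last qubit out of the segment, so the operator acts within each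
slice. -/
theorem slice_spinOp_initial {n i : ℕ} (hi : i ≤ n) (c : Fin 3) (b : Fin 2) (v : QState (n + 1)) :
    slice b (spinOp (Finset.univ.filter fun q : Fin (n + 1) => (q : ℕ) < i) c v) =
      spinOp (Finset.univ.filter fun q : Fin n => (q : ℕ) < i) c (slice b v) := by
  rw [spinOp, spinOp, Finset.sum_filter, Finset.sum_filter, Fin.sum_univ_castSucc, Fin.val_last,
    if_neg (by omega), add_zero, LinearMap.sum_apply, LinearMap.sum_apply, map_sum]
  refine Finset.sum_congr rfl fun q _ => ?_
  rw [Fin.val_castSucc]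
  split_ifs
  · simp only [LinearMap.smul_apply, map_smul, slice_qubitOp_castSucc]
  · simp

theorem slice_totalSpin_initial {n i : ℕ} (hi : i ≤ n) (b : Fin 2) (v : QState (n + 1)) :
    slice b (totalSpin (Finset.univ.filter fun q : Fin (n + 1) => (q : ℕ) < i) v) =
      totalSpin (Finset.univ.filter fun q : Fin n => (q : ℕ) < i) (slice b v) := by
  simp only [totalSpin, LinearMap.sum_apply, map_sum, Module.End.mul_apply,
    slice_spinOp_initial hi]

/-- The raising operator of all the qubits. -/
def spinRaise (n : ℕ) : QOp n := spinOp Finset.univ 0 + Complex.I • spinOp Finset.univ 1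

/-- The lowering operator of all the qubits. -/
def spinLower (n : ℕ) : QOp n := spinOp Finset.univ 0 - Complex.I • spinOp Finset.univ 1

/-! ### Ladder operators and `Z`-spin on slices -/

theorem slice_zero_spinRaise {n : ℕ} (v : QState (n + 1)) :
    slice 0 (spinRaise (n + 1) v) = spinRaise n (slice 0 v) + slice 1 v := by
  simp only [spinRaise, LinearMap.add_apply, LinearMap.smul_apply, map_add, map_smul,
    slice_spinOp_univ, Fin.sum_univ_two, pauli]
  simp
  match_scalars <;> ring_nf <;> simp [Complex.I_sq] <;> norm_num

theorem slice_one_spinRaise {n : ℕ} (v : QState (n + 1)) :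
    slice 1 (spinRaise (n + 1) v) = spinRaise n (slice 1 v) := by
  simp only [spinRaise, LinearMap.add_apply, LinearMap.smul_apply, map_add, map_smul,
    slice_spinOp_univ, Fin.sum_univ_two, pauli]
  simp
  match_scalars <;> ring_nf <;> simp [Complex.I_sq]

theorem slice_zero_spinLower {n : ℕ} (v : QState (n + 1)) :
    slice 0 (spinLower (n + 1) v) = spinLower n (slice 0 v) := by
  simp only [spinLower, LinearMap.sub_apply, LinearMap.smul_apply, map_sub, map_smul,
    slice_spinOp_univ, Fin.sum_univ_two, pauli]
  simp
  match_scalars <;> ring_nf <;> simp [Complex.I_sq]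

theorem slice_one_spinLower {n : ℕ} (v : QState (n + 1)) :
    slice 1 (spinLower (n + 1) v) = spinLower n (slice 1 v) + slice 0 v := by
  simp only [spinLower, LinearMap.sub_apply, LinearMap.smul_apply, map_sub, map_smul,
    slice_spinOp_univ, Fin.sum_univ_two, pauli]
  simp
  match_scalars <;> ring_nf <;> simp [Complex.I_sq] <;> norm_num

theorem slice_zSpin {n : ℕ} (b : Fin 2) (v : QState (n + 1)) :
    slice b (zSpin Finset.univ v) =
      zSpin Finset.univ (slice b v) + ((zBit b : ℂ) / 2) • slice b v := by
  simp only [zSpin, slice_spinOp_univ, Fin.sum_univ_two, pauli]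
  fin_cases b <;> simp [zBit]
  module

/-- The symmetrised product of the ladder operators is used, so that no commutation relation is
needed. -/
theorem totalSpin_univ_eq (n : ℕ) :
    totalSpin (Finset.univ : Finset (Fin n)) =
      (1 / 2 : ℂ) • (spinRaise n * spinLower n + spinLower n * spinRaise n) +
        zSpin Finset.univ * zSpin Finset.univ := by
  simp only [totalSpin, Fin.sum_univ_three, spinRaise, spinLower, zSpin, mul_add, add_mul, mul_sub,
    sub_mul, smul_mul_assoc, mul_smul_comm]
  match_scalars <;> ring_nf <;> simp [Complex.I_sq]

/-! ### Clebsch-Gordan coefficients -/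

theorem cgHalf_up_zero (d : ℕ) (z : ℤ) :
    cgHalf d (d + 1) z 0 = √((d : ℝ) + 1 + z) / √(2 * ((d : ℝ) + 1)) := by
  have : (0 : ℝ) < d + 1 := by positivity
  rw [cgHalf, if_pos rfl, if_pos rfl, ← Real.sqrt_div' _ (by positivity)]
  congr 1
  field_simp

theorem cgHalf_up_one (d : ℕ) (z : ℤ) :
    cgHalf d (d + 1) z 1 = √((d : ℝ) + 1 - z) / √(2 * ((d : ℝ) + 1)) := by
  have : (0 : ℝ) < d + 1 := by positivity
  rw [cgHalf, if_pos rfl, if_neg (by decide), ← Real.sqrt_div' _ (by positivity)]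
  congr 1
  field_simp

theorem cgHalf_down_zero (d : ℕ) (z : ℤ) :
    cgHalf (d + 1) d z 0 = -(√((d : ℝ) + 2 - z) / √(2 * ((d : ℝ) + 2))) := by
  have : (0 : ℝ) < d + 2 := by positivity
  rw [cgHalf, if_neg (by omega), if_pos rfl, if_pos rfl, ← Real.sqrt_div' _ (by positivity)]
  congr 2
  push_cast
  rw [show (d : ℝ) + 1 + 1 = d + 2 by ring]
  field_simp

theorem cgHalf_down_one (d : ℕ) (z : ℤ) :
    cgHalf (d + 1) d z 1 = √((d : ℝ) + 2 + z) / √(2 * ((d : ℝ) + 2)) := by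
  have : (0 : ℝ) < d + 2 := by positivity
  rw [cgHalf, if_neg (by omega), if_pos rfl, if_neg (by decide),
    ← Real.sqrt_div' _ (by positivity)]
  congr 1
  push_cast
  rw [show (d : ℝ) + 1 + 1 = d + 2 by ring]
  field_simp

/-- The matrix element `⟨j, m + 1| S₊ |j, m⟩`, with `d = 2j` and `z = 2m`. -/
def ladder (d : ℕ) (z : ℤ) : ℝ := √((d : ℝ) - z) * √((d : ℝ) + z + 2) / 2

/-- The `|0⟩`-slice of the relation `S₊|j, m⟩ ∝ |j, m + 1⟩`. The bound on `z` makes the radicands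
that get squared nonnegative; the `|1⟩`-slice in `cgHalf_raise_one` needs no bound, as the same
roots occur on both sides. -/
theorem cgHalf_raise_zero {d D : ℕ} (h : D = d + 1 ∨ d = D + 1) {z : ℤ} (hz : |z| ≤ (D : ℤ)) :
    cgHalf d D z 0 * ladder d (z - 1) + cgHalf d D z 1 =
      ladder D z * cgHalf d D (z + 2) 0 := by
  obtain ⟨h1, h2⟩ := abs_le.mp hz
  have h1' : -(D : ℝ) ≤ z := by exact_mod_cast h1
  have h2' : (z : ℝ) ≤ D := by exact_mod_cast h2
  rcases h with rfl | rfl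
  · simp only [cgHalf_up_zero, cgHalf_up_one, ladder]
    push_cast at h1' h2' ⊢
    rw [show (d : ℝ) - (z - 1) = d + 1 - z by ring, show (d : ℝ) + (z - 1) + 2 = d + 1 + z by ring,
      show (d : ℝ) + 1 + (z + 2) = d + 1 + z + 2 by ring]
    have hB : √((d : ℝ) + 1 + z) * √((d : ℝ) + 1 + z) = d + 1 + z :=
      Real.mul_self_sqrt (by linarith)
    have hC : √((d : ℝ) + 1 + z + 2) * √((d : ℝ) + 1 + z + 2) = d + 1 + z + 2 :=
      Real.mul_self_sqrt (by linarith)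
    linear_combination (√((d : ℝ) + 1 - z) / √(2 * ((d : ℝ) + 1)) / 2) * (hB - hC)
  · simp only [cgHalf_down_zero, cgHalf_down_one, ladder]
    push_cast
    rw [show (D : ℝ) + 1 - (z - 1) = D + 2 - z by ring,
      show (D : ℝ) + 1 + (z - 1) + 2 = D + 2 + z by ring,
      show (D : ℝ) + z + 2 = D + 2 + z by ring, show (D : ℝ) + 2 - (z + 2) = D - z by ring]
    have hB : √((D : ℝ) + 2 - z) * √((D : ℝ) + 2 - z) = D + 2 - z :=
      Real.mul_self_sqrt (by linarith)
    have hC : √((D : ℝ) - z) * √((D : ℝ) - z) = D - z :=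
      Real.mul_self_sqrt (by linarith)
    linear_combination (√((D : ℝ) + 2 + z) / √(2 * ((D : ℝ) + 2)) / 2) * (hC - hB)

theorem cgHalf_raise_one {d D : ℕ} (h : D = d + 1 ∨ d = D + 1) (z : ℤ) :
    cgHalf d D z 1 * ladder d (z + 1) = ladder D z * cgHalf d D (z + 2) 1 := by
  rcases h with rfl | rfl
  · simp only [cgHalf_up_one, ladder]
    push_cast
    rw [show (d : ℝ) - (z + 1) = d - 1 - z by ring,
      show (d : ℝ) + (z + 1) + 2 = d + 1 + z + 2 by ring,
      show (d : ℝ) + 1 - (z + 2) = d - 1 - z by ring]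
    ring
  · simp only [cgHalf_down_one, ladder]
    push_cast
    rw [show (D : ℝ) + 1 - (z + 1) = D - z by ring,
      show (D : ℝ) + 1 + (z + 1) + 2 = D + 2 + (z + 2) by ring,
      show (D : ℝ) + z + 2 = D + 2 + z by ring]
    ring

theorem cgHalf_lower_one {d D : ℕ} (h : D = d + 1 ∨ d = D + 1) {z : ℤ} (hz : |z| ≤ (D : ℤ)) :
    cgHalf d D z 1 * ladder d (-(z + 1)) + cgHalf d D z 0 =
      ladder D (-z) * cgHalf d D (z - 2) 1 := by
  obtain ⟨h1, h2⟩ := abs_le.mp hz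
  have h1' : -(D : ℝ) ≤ z := by exact_mod_cast h1
  have h2' : (z : ℝ) ≤ D := by exact_mod_cast h2
  rcases h with rfl | rfl
  · simp only [cgHalf_up_zero, cgHalf_up_one, ladder]
    push_cast at h1' h2' ⊢
    rw [show (d : ℝ) - (-(z + 1)) = d + 1 + z by ring,
      show (d : ℝ) + (-(z + 1)) + 2 = d + 1 - z by ring,
      show (d : ℝ) + 1 - (z - 2) = d + 1 - z + 2 by ring,
      show (d : ℝ) + 1 - -z = d + 1 + z by ring,
      show (d : ℝ) + 1 + -z + 2 = d + 1 - z + 2 by ring]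
    have hB : √((d : ℝ) + 1 - z) * √((d : ℝ) + 1 - z) = d + 1 - z :=
      Real.mul_self_sqrt (by linarith)
    have hC : √((d : ℝ) + 1 - z + 2) * √((d : ℝ) + 1 - z + 2) = d + 1 - z + 2 :=
      Real.mul_self_sqrt (by linarith)
    linear_combination (√((d : ℝ) + 1 + z) / √(2 * ((d : ℝ) + 1)) / 2) * (hB - hC)
  · simp only [cgHalf_down_zero, cgHalf_down_one, ladder]
    push_cast
    rw [show (D : ℝ) + 1 - (-(z + 1)) = D + 2 + z by ring,
      show (D : ℝ) + 1 + (-(z + 1)) + 2 = D + 2 - z by ring,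
      show (D : ℝ) + -z + 2 = D + 2 - z by ring, show (D : ℝ) + 2 + (z - 2) = D + z by ring,
      show (D : ℝ) - -z = D + z by ring]
    have hB : √((D : ℝ) + 2 + z) * √((D : ℝ) + 2 + z) = D + 2 + z :=
      Real.mul_self_sqrt (by linarith)
    have hC : √((D : ℝ) + z) * √((D : ℝ) + z) = D + z :=
      Real.mul_self_sqrt (by linarith)
    linear_combination (√((D : ℝ) + 2 - z) / √(2 * ((D : ℝ) + 2)) / 2) * (hB - hC)

theorem cgHalf_lower_zero {d D : ℕ} (h : D = d + 1 ∨ d = D + 1) (z : ℤ) :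
    cgHalf d D z 0 * ladder d (-(z - 1)) = ladder D (-z) * cgHalf d D (z - 2) 0 := by
  rcases h with rfl | rfl
  · simp only [cgHalf_up_zero, ladder]
    push_cast
    rw [show (d : ℝ) - (-(z - 1)) = d - 1 + z by ring,
      show (d : ℝ) + (-(z - 1)) + 2 = d + 1 + -z + 2 by ring,
      show (d : ℝ) + 1 + (z - 2) = d - 1 + z by ring,
      show (d : ℝ) + 1 - -z = d + 1 + z by ring]
    ring
  · simp only [cgHalf_down_zero, ladder]
    push_cast
    rw [show (D : ℝ) + 1 - (-(z - 1)) = D - -z by ring,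
      show (D : ℝ) + 1 + (-(z - 1)) + 2 = D + 2 - (z - 2) by ring,
      show (D : ℝ) + -z + 2 = D + 2 - z by ring]
    ring

/-! ### Coupling the qubits one after the other -/

/-- `z / 2` is a possible `Z`-spin for the spin `d / 2`. -/
def IsZSpin (d : ℕ) (z : ℤ) : Prop := |z| ≤ (d : ℤ) ∧ Even (z + (d : ℤ))

/-- `k` lists (the doubles of) possible total spins of the initial segments of `n` qubits. -/
def IsSpinPath (k : ℕ → ℕ) (n : ℕ) : Prop :=
  k 0 = 0 ∧ ∀ i < n, k (i + 1) = k i + 1 ∨ k i = k (i + 1) + 1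

theorem IsSpinPath.of_succ {k : ℕ → ℕ} {n : ℕ} (h : IsSpinPath k (n + 1)) : IsSpinPath k n :=
  ⟨h.1, fun i hi => h.2 i (by omega)⟩

theorem IsSpinPath.mem_spins {k : ℕ → ℕ} {n : ℕ} (h : IsSpinPath k n) : k n ∈ spins n := by
  induction n with
  | zero => simp [spins, h.1]
  | succ n ih =>
    have := ih h.of_succ
    have := h.2 n (by omega)
    simp only [spins, Finset.mem_filter, Finset.mem_range] at *
    omega

/-- The state with spins `k` and `Z`-spin `z / 2` obtained by coupling `n` qubits one after the
other; it is `0` if `z / 2` is not a possible `Z`-spin. -/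
def schurVec (k : ℕ → ℕ) : (n : ℕ) → ℤ → QState n
  | 0, z => WithLp.toLp 2 fun _ => if z = 0 then 1 else 0
  | n + 1, z => ∑ b, attach b
      (((cgHalf (k n) (k (n + 1)) z b : ℝ) : ℂ) • schurVec k n (z - zBit b))

theorem slice_schurVec (k : ℕ → ℕ) (n : ℕ) (z : ℤ) (b : Fin 2) :
    slice b (schurVec k (n + 1) z) =
      ((cgHalf (k n) (k (n + 1)) z b : ℝ) : ℂ) • schurVec k n (z - zBit b) := by
  rw [schurVec]
  fin_cases b <;> simp [slice_attach]

theorem slice_zero_schurVec (k : ℕ → ℕ) (n : ℕ) (z : ℤ) :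
    slice 0 (schurVec k (n + 1) z) =
      ((cgHalf (k n) (k (n + 1)) z 0 : ℝ) : ℂ) • schurVec k n (z - 1) :=
  slice_schurVec k n z 0

theorem slice_one_schurVec (k : ℕ → ℕ) (n : ℕ) (z : ℤ) :
    slice 1 (schurVec k (n + 1) z) =
      ((cgHalf (k n) (k (n + 1)) z 1 : ℝ) : ℂ) • schurVec k n (z + 1) := by
  rw [slice_schurVec, zBit, if_neg (by decide), sub_neg_eq_add]

/-- Matches the recursive construction with the closed product formula defining `schurState`. -/
theorem schurVec_apply (k : ℕ → ℕ) (n : ℕ) (z : ℤ) (x : Fin n → Fin 2) :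
    schurVec k n z x = if ∑ l, zBit (x l) = z then
      ((∏ i : Fin n, cgHalf (k i) (k (i + 1)) (∑ l ∈ Finset.Iic i, zBit (x l)) (x i) : ℝ) : ℂ)
      else 0 := by
  induction n generalizing z with
  | zero => simp [schurVec, eq_comm]
  | succ n ih =>
    have hlast : Finset.Iic (Fin.last n) = Finset.univ := by
      ext l; simp [Fin.le_last]
    conv_lhs => rw [← Fin.snoc_init_self x, ← slice_apply, slice_schurVec]
    rw [PiLp.smul_apply, ih, Fin.prod_univ_castSucc, Fin.sum_univ_castSucc]
    simp only [Fin.sum_Iic_castSucc, Fin.val_castSucc, Fin.val_last, hlast]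
    rw [Fin.sum_univ_castSucc]
    simp only [eq_sub_iff_add_eq, Fin.init]
    split_ifs with h
    · rw [h]
      push_cast
      rw [smul_eq_mul, mul_comm]
    · simp

/-- By parity, a `Z`-spin allowed before the coupling and forbidden after it occurs only for a
coupling downwards with `z = ±(D + 2)`, where the radicand is exactly zero. -/
theorem cgHalf_eq_zero_of_not_isZSpin {d D : ℕ} (h : D = d + 1 ∨ d = D + 1) {z : ℤ} {b : Fin 2}
    (hz : ¬ IsZSpin D z) (hzb : IsZSpin d (z - zBit b)) : cgHalf d D z b = 0 := by
  obtain ⟨h1, h2⟩ := hzb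
  have hb : b = 0 ∧ zBit b = 1 ∨ b = 1 ∧ zBit b = -1 := by fin_cases b <;> simp [zBit]
  have hev : Even (z + (D : ℤ)) := by
    rw [Int.even_iff] at h2 ⊢
    omega
  have hgt : ¬ |z| ≤ (D : ℤ) := fun h' => hz ⟨h', hev⟩
  rw [abs_le] at h1 hgt
  rcases h with rfl | rfl
  · omega
  · rcases hb with ⟨rfl, hb⟩ | ⟨rfl, hb⟩
    · have : z = (D : ℤ) + 2 := by
        rw [Int.even_iff] at h2; push_cast at *; omega
      rw [cgHalf_down_zero, this]; simp
    · have : z = -((D : ℤ) + 2) := by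
        rw [Int.even_iff] at h2; push_cast at *; omega
      rw [cgHalf_down_one, this]; simp

theorem schurVec_eq_zero {k : ℕ → ℕ} {n : ℕ} (hk : IsSpinPath k n) {z : ℤ}
    (hz : ¬ IsZSpin (k n) z) : schurVec k n z = 0 := by
  induction n generalizing z with
  | zero =>
    ext x
    have : z ≠ 0 := by
      rintro rfl
      exact hz (by simp [IsZSpin, hk.1])
    simp [schurVec, this]
  | succ n ih =>
    refine ext_slice fun b => ?_
    rw [slice_schurVec, map_zero]
    by_cases hzb : IsZSpin (k n) (z - zBit b)
    · rw [cgHalf_eq_zero_of_not_isZSpin (hk.2 n (by omega)) hz hzb]; simp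
    · rw [ih hk.of_succ hzb, smul_zero]

theorem zSpin_schurVec (k : ℕ → ℕ) (n : ℕ) (z : ℤ) :
    zSpin Finset.univ (schurVec k n z) = ((z : ℂ) / 2) • schurVec k n z := by
  induction n generalizing z with
  | zero =>
    ext x
    by_cases hz : z = 0 <;> simp [schurVec, zSpin, spinOp, hz]
  | succ n ih =>
    refine ext_slice fun b => ?_
    rw [slice_zSpin, map_smul, slice_schurVec, map_smul, ih]
    push_cast
    module

/-- The only case where the raised vector could survive is `z = -(k n + 2)`, and there the ladder
coefficient has a factor `√0`. This lets the raising formula hold for every integer `z`, which the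
induction needs since slicing shifts `z` out of range at the ends. -/
theorem ladder_smul_schurVec_of_not_isZSpin {k : ℕ → ℕ} {n : ℕ} (hk : IsSpinPath k n) {z : ℤ}
    (hz : ¬ IsZSpin (k n) z) :
    ((ladder (k n) z : ℝ) : ℂ) • schurVec k n (z + 2) = 0 := by
  by_cases hz' : IsZSpin (k n) (z + 2)
  · have : z = -((k n : ℤ) + 2) := by
      simp only [IsZSpin, abs_le, Int.even_iff] at hz hz'
      omega
    rw [ladder, this]
    simp
  · rw [schurVec_eq_zero hk hz', smul_zero]

theorem ladder_neg_smul_schurVec_of_not_isZSpin {k : ℕ → ℕ} {n : ℕ} (hk : IsSpinPath k n) {z : ℤ}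
    (hz : ¬ IsZSpin (k n) z) :
    ((ladder (k n) (-z) : ℝ) : ℂ) • schurVec k n (z - 2) = 0 := by
  by_cases hz' : IsZSpin (k n) (z - 2)
  · have : z = (k n : ℤ) + 2 := by
      simp only [IsZSpin, abs_le, Int.even_iff] at hz hz'
      omega
    rw [ladder, this]
    simp
  · rw [schurVec_eq_zero hk hz', smul_zero]

/-- Both sides are compared slice by slice; the induction hypothesis reduces each slice to one of
the two ladder identities for `cgHalf`. -/
theorem spinRaise_schurVec {k : ℕ → ℕ} {n : ℕ} (hk : IsSpinPath k n) (z : ℤ) :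
    spinRaise n (schurVec k n z) = ((ladder (k n) z : ℝ) : ℂ) • schurVec k n (z + 2) := by
  induction n generalizing z with
  | zero =>
    by_cases hz : IsZSpin (k 0) z
    · have : z = 0 := by simpa [IsZSpin, hk.1] using hz.1
      simp [spinRaise, spinOp, this, ladder, hk.1]
    · rw [ladder_smul_schurVec_of_not_isZSpin hk hz]
      simp [spinRaise, spinOp]
  | succ n ih =>
    by_cases hz : IsZSpin (k (n + 1)) z
    · have hs := hk.2 n (by omega)
      refine ext_slice fun b => ?_
      obtain rfl | rfl : b = 0 ∨ b = 1 := by fin_cases b <;> simp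
      · rw [slice_zero_spinRaise, map_smul, slice_zero_schurVec, slice_zero_schurVec,
          slice_one_schurVec, map_smul, ih hk.of_succ, show z - 1 + 2 = z + 1 by ring,
          show z + 2 - 1 = z + 1 by ring, smul_smul, smul_smul, ← add_smul]
        congr 1
        exact_mod_cast cgHalf_raise_zero hs hz.1
      · rw [slice_one_spinRaise, map_smul, slice_one_schurVec, slice_one_schurVec, map_smul,
          ih hk.of_succ, show z + 1 + 2 = z + 2 + 1 by ring, smul_smul, smul_smul]
        congr 1
        exact_mod_cast cgHalf_raise_one hs z
    · rw [ladder_smul_schurVec_of_not_isZSpin hk hz, schurVec_eq_zero hk hz, map_zero]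

theorem spinLower_schurVec {k : ℕ → ℕ} {n : ℕ} (hk : IsSpinPath k n) (z : ℤ) :
    spinLower n (schurVec k n z) = ((ladder (k n) (-z) : ℝ) : ℂ) • schurVec k n (z - 2) := by
  induction n generalizing z with
  | zero =>
    by_cases hz : IsZSpin (k 0) z
    · have : z = 0 := by simpa [IsZSpin, hk.1] using hz.1
      simp [spinLower, spinOp, this, ladder, hk.1]
    · rw [ladder_neg_smul_schurVec_of_not_isZSpin hk hz]
      simp [spinLower, spinOp]
  | succ n ih =>
    by_cases hz : IsZSpin (k (n + 1)) z
    · have hs := hk.2 n (by omega)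
      refine ext_slice fun b => ?_
      obtain rfl | rfl : b = 0 ∨ b = 1 := by fin_cases b <;> simp
      · rw [slice_zero_spinLower, map_smul, slice_zero_schurVec, slice_zero_schurVec, map_smul,
          ih hk.of_succ, show z - 1 - 2 = z - 2 - 1 by ring, smul_smul, smul_smul]
        congr 1
        exact_mod_cast cgHalf_lower_zero hs z
      · rw [slice_one_spinLower, map_smul, slice_one_schurVec, slice_one_schurVec,
          slice_zero_schurVec, map_smul, ih hk.of_succ, show z + 1 - 2 = z - 1 by ring,
          show z - 2 + 1 = z - 1 by ring, smul_smul, smul_smul, ← add_smul]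
        congr 1
        exact_mod_cast cgHalf_lower_one hs hz.1
    · rw [ladder_neg_smul_schurVec_of_not_isZSpin hk hz, schurVec_eq_zero hk hz, map_zero]

theorem ladder_mul_ladder_neg {d : ℕ} {z : ℤ} (hz : IsZSpin d z) :
    ladder d z * ladder d (-(z + 2)) = ((d : ℝ) - z) * (d + z + 2) / 4 := by
  obtain ⟨h1, h2⟩ := abs_le.mp hz.1
  have h1' : -(d : ℝ) ≤ z := by exact_mod_cast h1
  have h2' : (z : ℝ) ≤ d := by exact_mod_cast h2
  simp only [ladder]
  push_cast
  rw [show (d : ℝ) - -(z + 2) = d + z + 2 by ring, show (d : ℝ) + -(z + 2) + 2 = d - z by ring]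
  have hB : √((d : ℝ) - z) * √((d : ℝ) - z) = d - z := Real.mul_self_sqrt (by linarith)
  have hC : √((d : ℝ) + z + 2) * √((d : ℝ) + z + 2) = d + z + 2 :=
    Real.mul_self_sqrt (by linarith)
  linear_combination (√((d : ℝ) + z + 2) * √((d : ℝ) + z + 2) / 4) * hB + ((d : ℝ) - z) / 4 * hC

theorem totalSpin_univ_schurVec {k : ℕ → ℕ} {n : ℕ} (hk : IsSpinPath k n) (z : ℤ) :
    totalSpin Finset.univ (schurVec k n z) =
      ((k n : ℂ) / 2 * ((k n : ℂ) / 2 + 1)) • schurVec k n z := by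
  by_cases hz : IsZSpin (k n) z
  swap
  · rw [schurVec_eq_zero hk hz, map_zero, smul_zero]
  have hz' : IsZSpin (k n) (-z) := by
    obtain ⟨h1, h2⟩ := hz
    refine ⟨by rwa [abs_neg], ?_⟩
    rw [Int.even_iff] at h2 ⊢
    omega
  have e1 : ((ladder (k n) z : ℝ) : ℂ) * ((ladder (k n) (-(z + 2)) : ℝ) : ℂ) =
      ((k n : ℂ) - z) * (k n + z + 2) / 4 := by exact_mod_cast ladder_mul_ladder_neg hz
  have e2 : ((ladder (k n) (-z) : ℝ) : ℂ) * ((ladder (k n) (z - 2) : ℝ) : ℂ) =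
      ((k n : ℂ) + z) * (k n - z + 2) / 4 := by
    have := ladder_mul_ladder_neg hz'
    rw [show -(-z + 2) = z - 2 by ring] at this
    rw [← Complex.ofReal_mul, this]
    push_cast
    ring
  rw [totalSpin_univ_eq]
  simp only [LinearMap.add_apply, LinearMap.smul_apply, Module.End.mul_apply,
    spinRaise_schurVec hk, spinLower_schurVec hk, zSpin_schurVec, map_smul, smul_smul,
    sub_add_cancel, add_sub_cancel_right, e1, e2]
  match_scalars
  ring

/-- Qubits outside the segment are sliced off one at a time, until the segment is the whole
register. -/
theorem totalSpin_initial_schurVec {k : ℕ → ℕ} {n : ℕ} (hk : IsSpinPath k n) (z : ℤ) {i : ℕ}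
    (hi : i ≤ n) :
    totalSpin (Finset.univ.filter fun q : Fin n => (q : ℕ) < i) (schurVec k n z) =
      ((k i : ℂ) / 2 * ((k i : ℂ) / 2 + 1)) • schurVec k n z := by
  rcases hi.eq_or_lt with rfl | hlt
  · have : (Finset.univ.filter fun q : Fin i => (q : ℕ) < i) = Finset.univ := by
      ext q; simp
    rw [this, totalSpin_univ_schurVec hk]
  · induction n generalizing z with
    | zero => omega
    | succ n ih =>
      refine ext_slice fun b => ?_
      rw [slice_totalSpin_initial (by omega), map_smul, slice_schurVec, map_smul]
      rcases (Nat.lt_succ_iff.mp hlt).eq_or_lt with rfl | hlt'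
      · have : (Finset.univ.filter fun q : Fin i => (q : ℕ) < i) = Finset.univ := by
          ext q; simp
        rw [this, totalSpin_univ_schurVec hk.of_succ, smul_comm]
      · rw [ih hk.of_succ _ (by omega) hlt', smul_comm]

/-! ### Orthonormality and completeness -/

theorem cgHalf_sq_add_sq {d D : ℕ} (h : D = d + 1 ∨ d = D + 1) {z : ℤ} (hz : |z| ≤ (D : ℤ)) :
    cgHalf d D z 0 * cgHalf d D z 0 + cgHalf d D z 1 * cgHalf d D z 1 = 1 := by
  obtain ⟨h1, h2⟩ := abs_le.mp hz
  have h1' : -(D : ℝ) ≤ z := by exact_mod_cast h1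
  have h2' : (z : ℝ) ≤ D := by exact_mod_cast h2
  rcases h with rfl | rfl
  · push_cast at h1' h2'
    rw [cgHalf_up_zero, cgHalf_up_one, div_mul_div_comm, div_mul_div_comm,
      Real.mul_self_sqrt (by linarith), Real.mul_self_sqrt (by linarith),
      Real.mul_self_sqrt (by positivity)]
    field_simp
    ring
  · rw [cgHalf_down_zero, cgHalf_down_one, neg_mul_neg, div_mul_div_comm, div_mul_div_comm,
      Real.mul_self_sqrt (by linarith), Real.mul_self_sqrt (by positivity),
      Real.mul_self_sqrt (by linarith)]
    field_simp
    ring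

theorem cgHalf_orthogonal {d D D' : ℕ} (h : D = d + 1 ∨ d = D + 1)
    (h' : D' = d + 1 ∨ d = D' + 1) (hD : D ≠ D') (z : ℤ) :
    cgHalf d D z 0 * cgHalf d D' z 0 + cgHalf d D z 1 * cgHalf d D' z 1 = 0 := by
  have key : ∀ e : ℕ, cgHalf (e + 1) (e + 2) z 0 * cgHalf (e + 1) e z 0 +
      cgHalf (e + 1) (e + 2) z 1 * cgHalf (e + 1) e z 1 = 0 := by
    intro e
    rw [cgHalf_up_zero, cgHalf_up_one, cgHalf_down_zero, cgHalf_down_one]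
    push_cast
    rw [show (e : ℝ) + 1 + 1 = e + 2 by ring]
    ring
  rcases h with rfl | rfl <;> rcases h' with h' | h'
  · omega
  · subst h'
    exact key D'
  · subst h'
    rw [← key D]
    ring
  · omega

/-- The converse boundary case: a forbidden `Z`-spin before an upward coupling means `z = ±(d + 1)`,
where the coefficient is `√0`. It removes the slices to which the induction in `inner_schurVec` does
not apply. -/
theorem cgHalf_eq_zero_of_not_isZSpin_sub {d D : ℕ} (h : D = d + 1 ∨ d = D + 1) {z : ℤ}
    {b : Fin 2} (hz : IsZSpin D z) (hzb : ¬ IsZSpin d (z - zBit b)) : cgHalf d D z b = 0 := by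
  obtain ⟨h1, h2⟩ := hz
  have hb : b = 0 ∧ zBit b = 1 ∨ b = 1 ∧ zBit b = -1 := by fin_cases b <;> simp [zBit]
  simp only [IsZSpin, abs_le, Int.even_iff] at hzb h1 h2
  rcases h with rfl | rfl
  · rcases hb with ⟨rfl, hb⟩ | ⟨rfl, hb⟩
    · have : z = -((d : ℤ) + 1) := by push_cast at *; omega
      rw [cgHalf_up_zero, this]; simp
    · have : z = (d : ℤ) + 1 := by push_cast at *; omega
      rw [cgHalf_up_one, this]; simp
  · push_cast at *; omega

-- The inner product is the sum over the two slices. Induction settles all labels but the last spin;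
-- the rows of the Clebsch–Gordan matrix, being orthonormal, settle that one.
open Classical in
theorem inner_schurVec {k k' : ℕ → ℕ} {n : ℕ} (hk : IsSpinPath k n) (hk' : IsSpinPath k' n)
    {z z' : ℤ} (hz : IsZSpin (k n) z) (hz' : IsZSpin (k' n) z') :
    inner ℂ (schurVec k n z) (schurVec k' n z') =
      if (∀ i ≤ n, k i = k' i) ∧ z = z' then 1 else 0 := by
  induction n generalizing z z' with
  | zero =>
    have e : z = 0 := by simpa [IsZSpin, hk.1] using hz.1
    have e' : z' = 0 := by simpa [IsZSpin, hk'.1] using hz'.1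
    have : ∀ i ≤ 0, k i = k' i := by
      intro i hi
      rw [Nat.le_zero.mp hi, hk.1, hk'.1]
    rw [if_pos ⟨this, by rw [e, e']⟩]
    rw [PiLp.inner_apply]
    simp [schurVec, e, e']
  | succ n ih =>
    have hs := hk.2 n (by omega)
    have hs' := hk'.2 n (by omega)
    have hterm : ∀ b, inner ℂ (slice b (schurVec k (n + 1) z))
        (slice b (schurVec k' (n + 1) z')) = if (∀ i ≤ n, k i = k' i) ∧ z = z' then
          ((cgHalf (k n) (k (n + 1)) z b * cgHalf (k' n) (k' (n + 1)) z' b : ℝ) : ℂ) else 0 := by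
      intro b
      rw [slice_schurVec, slice_schurVec, inner_smul_left, inner_smul_right, Complex.conj_ofReal]
      by_cases h1 : IsZSpin (k n) (z - zBit b)
      · by_cases h2 : IsZSpin (k' n) (z' - zBit b)
        · rw [ih hk.of_succ hk'.of_succ h1 h2]
          simp only [sub_left_inj]
          split_ifs <;> simp
        · rw [cgHalf_eq_zero_of_not_isZSpin_sub hs' hz' h2]
          simp
      · rw [cgHalf_eq_zero_of_not_isZSpin_sub hs hz h1]
        simp
    rw [inner_eq_sum_slice, Fin.sum_univ_two, hterm, hterm]
    by_cases h : (∀ i ≤ n, k i = k' i) ∧ z = z'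
    · obtain ⟨hkk, rfl⟩ := h
      have hn := hkk n le_rfl
      rw [if_pos ⟨hkk, rfl⟩, if_pos ⟨hkk, rfl⟩, ← hn, ← Complex.ofReal_add]
      by_cases hl : k (n + 1) = k' (n + 1)
      · have : ∀ i ≤ n + 1, k i = k' i := by
          intro i hi
          rcases hi.eq_or_lt with rfl | hi
          · exact hl
          · exact hkk i (by omega)
        rw [if_pos ⟨this, rfl⟩, ← hl, cgHalf_sq_add_sq hs hz.1, Complex.ofReal_one]
      · rw [if_neg fun h => hl (h.1 _ le_rfl), cgHalf_orthogonal hs (hn ▸ hs') hl,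
          Complex.ofReal_zero]
    · rw [if_neg h, if_neg h, if_neg fun h' => h ⟨fun i hi => h'.1 i (by omega), h'.2⟩, add_zero]

/-- Orthonormality of the columns. The initial spin is written `d + 1` because spin zero admits only
the upward coupling. -/
theorem cgHalf_complete (d : ℕ) {z : ℤ} (hz : |z| ≤ (d : ℤ) + 2) (b b' : Fin 2) :
    cgHalf (d + 1) (d + 2) z b * cgHalf (d + 1) (d + 2) z b' +
      cgHalf (d + 1) d z b * cgHalf (d + 1) d z b' = if b' = b then 1 else 0 := by
  obtain ⟨h1, h2⟩ := abs_le.mp hz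
  have h1' : -((d : ℝ) + 2) ≤ z := by exact_mod_cast h1
  have h2' : (z : ℝ) ≤ d + 2 := by exact_mod_cast h2
  have hB : √((d : ℝ) + 2 + z) * √((d : ℝ) + 2 + z) = d + 2 + z :=
    Real.mul_self_sqrt (by linarith)
  have hC : √((d : ℝ) + 2 - z) * √((d : ℝ) + 2 - z) = d + 2 - z :=
    Real.mul_self_sqrt (by linarith)
  have hD : √(2 * ((d : ℝ) + 2)) * √(2 * ((d : ℝ) + 2)) = 2 * (d + 2) :=
    Real.mul_self_sqrt (by positivity)
  have hpos : (0 : ℝ) < d + 2 := by positivity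
  have h0 := cgHalf_up_zero (d + 1) z
  have h1 := cgHalf_up_one (d + 1) z
  push_cast at h0 h1
  rw [show (d : ℝ) + 1 + 1 = d + 2 by ring] at h0 h1
  have diag : ∀ x y : ℝ, x / √(2 * ((d : ℝ) + 2)) * (x / √(2 * ((d : ℝ) + 2))) +
      y / √(2 * ((d : ℝ) + 2)) * (y / √(2 * ((d : ℝ) + 2))) =
        (x * x + y * y) / (2 * (d + 2)) := by
    intro x y
    rw [div_mul_div_comm, div_mul_div_comm, hD, add_div]
  obtain rfl | rfl : b = 0 ∨ b = 1 := by fin_cases b <;> simp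
  all_goals
    obtain rfl | rfl : b' = 0 ∨ b' = 1 := by fin_cases b' <;> simp
    all_goals
      simp only [h0, h1, cgHalf_down_zero, cgHalf_down_one, neg_mul_neg]
  · rw [diag, hB, hC, if_pos trivial]
    field_simp
    ring
  · rw [if_neg (by decide)]
    ring
  · rw [if_neg (by decide)]
    ring
  · rw [diag, hB, hC, if_pos trivial]
    field_simp
    ring

theorem schurVec_congr {k k' : ℕ → ℕ} {n : ℕ} (h : ∀ i ≤ n, k i = k' i) (z : ℤ) :
    schurVec k n z = schurVec k' n z := by
  induction n generalizing z with
  | zero => rfl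
  | succ n ih =>
    simp only [schurVec, ih fun i hi => h i (by omega), h n (by omega), h (n + 1) le_rfl]

theorem IsSpinPath.update {k : ℕ → ℕ} {n : ℕ} (hk : IsSpinPath k n) {D : ℕ}
    (hD : D = k n + 1 ∨ k n = D + 1) : IsSpinPath (Function.update k (n + 1) D) (n + 1) := by
  refine ⟨by simpa using hk.1, fun i hi => ?_⟩
  rcases (Nat.lt_succ_iff.mp hi).eq_or_lt with rfl | hi'
  · simpa using hD
  · rw [Function.update_of_ne (by omega), Function.update_of_ne (by omega)]
    exact hk.2 i hi'

theorem slice_schurVec_update (k : ℕ → ℕ) (n D : ℕ) (z : ℤ) (b : Fin 2) :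
    slice b (schurVec (Function.update k (n + 1) D) (n + 1) z) =
      ((cgHalf (k n) D z b : ℝ) : ℂ) • schurVec k n (z - zBit b) := by
  rw [slice_schurVec, Function.update_self, Function.update_of_ne (by omega),
    schurVec_congr fun i hi => Function.update_of_ne (by omega) _ _]

/-- The states obtained by coupling `n` qubits one after the other. -/
def schurVecs (n : ℕ) : Set (QState n) :=
  {v | ∃ k z, IsSpinPath k n ∧ IsZSpin (k n) z ∧ schurVec k n z = v}

theorem schurVec_mem_span {k : ℕ → ℕ} {n : ℕ} (hk : IsSpinPath k n) (z : ℤ) :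
    schurVec k n z ∈ Submodule.span ℂ (schurVecs n) := by
  by_cases hz : IsZSpin (k n) z
  · exact Submodule.subset_span ⟨k, z, hk, hz, rfl⟩
  · rw [schurVec_eq_zero hk hz]
    exact Submodule.zero_mem _

/-- Inverts the coupling: a product state is the combination of the upward and downward couplings
whose weights are the same real Clebsch–Gordan coefficients. -/
theorem attach_schurVec_mem_span {k : ℕ → ℕ} {n : ℕ} (hk : IsSpinPath k n) {z : ℤ}
    (hz : IsZSpin (k n) z) (b : Fin 2) :
    attach b (schurVec k n z) ∈ Submodule.span ℂ (schurVecs (n + 1)) := by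
  have hb : b = 0 ∧ zBit b = 1 ∨ b = 1 ∧ zBit b = -1 := by fin_cases b <;> simp [zBit]
  have hup := schurVec_mem_span (hk.update (.inl rfl)) (z + zBit b)
  have hcases : k n = 0 ∨ ∃ d, k n = d + 1 := by
    cases k n <;> simp
  rcases hcases with h0 | ⟨d, hd⟩
  -- From spin zero the only coupling is upwards, with coefficient `1`.
  · have hz0 : z = 0 := by simpa [IsZSpin, h0] using hz.1
    convert hup using 1
    refine ext_slice fun b' => ?_
    rw [slice_attach, slice_schurVec_update, h0, hz0]
    rcases hb with ⟨rfl, hb⟩ | ⟨rfl, hb⟩ <;>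
      obtain rfl | rfl : b' = 0 ∨ b' = 1 := by fin_cases b' <;> simp
    all_goals simp [zBit, cgHalf]
    all_goals norm_num
  · have hdown := schurVec_mem_span (hk.update (.inr hd)) (z + zBit b)
    have habs : |z + zBit b| ≤ (d : ℤ) + 2 := by
      have := abs_le.mp hz.1
      rw [abs_le]
      omega
    convert Submodule.add_mem _
      (Submodule.smul_mem _ ((cgHalf (d + 1) (d + 2) (z + zBit b) b : ℝ) : ℂ) hup)
      (Submodule.smul_mem _ ((cgHalf (d + 1) d (z + zBit b) b : ℝ) : ℂ) hdown) using 1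
    refine ext_slice fun b' => ?_
    rw [slice_attach, map_add, map_smul, map_smul, slice_schurVec_update, slice_schurVec_update, hd,
      smul_smul, smul_smul, ← add_smul, ← Complex.ofReal_mul, ← Complex.ofReal_mul,
      ← Complex.ofReal_add, cgHalf_complete d habs]
    split_ifs with h
    · rw [h]; simp
    · simp

theorem span_schurVecs (n : ℕ) : Submodule.span ℂ (schurVecs n) = ⊤ := by
  induction n with
  | zero =>
    rw [eq_top_iff]
    intro v _
    have hk : IsSpinPath (fun _ => 0) 0 := ⟨rfl, fun i hi => absurd hi (by omega)⟩
    have : v = v default • schurVec (fun _ => 0) 0 0 := by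
      ext x
      rw [Subsingleton.elim x default]
      simp [schurVec]
    rw [this]
    exact Submodule.smul_mem _ _ (schurVec_mem_span hk 0)
  | succ n ih =>
    rw [eq_top_iff]
    intro v _
    rw [← sum_attach_slice v]
    refine Submodule.sum_mem _ fun b _ => ?_
    have hle : Submodule.span ℂ (schurVecs n) ≤
        (Submodule.span ℂ (schurVecs (n + 1))).comap (attach b) := by
      rw [Submodule.span_le]
      rintro _ ⟨k, z, hk, hz, rfl⟩
      exact attach_schurVec_mem_span hk hz b
    exact hle (ih ▸ Submodule.mem_top)

theorem ext_schurVec {n : ℕ} {T T' : QOp n}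
    (h : ∀ k z, IsSpinPath k n → IsZSpin (k n) z → T (schurVec k n z) = T' (schurVec k n z)) :
    T = T' := by
  refine LinearMap.ext_on (span_schurVecs n) ?_
  rintro _ ⟨k, z, hk, hz, rfl⟩
  exact h k z hk hz

/-! ### Schur states -/

/-- The spins of a label as a sequence, extended by `0`. -/
def SchurLabel.path {n : ℕ} (ℓ : SchurLabel n) (i : ℕ) : ℕ :=
  if h : i < n + 1 then ℓ.spin ⟨i, h⟩ else 0

theorem SchurLabel.path_eq {n : ℕ} (ℓ : SchurLabel n) {i : ℕ} (h : i < n + 1) :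
    ℓ.path i = ℓ.spin ⟨i, h⟩ := dif_pos h

theorem SchurLabel.isSpinPath {n : ℕ} (ℓ : SchurLabel n) : IsSpinPath ℓ.path n := by
  refine ⟨(ℓ.path_eq (by omega)).trans ℓ.spin_zero, fun i hi => ?_⟩
  rw [ℓ.path_eq (by omega), ℓ.path_eq (by omega)]
  exact ℓ.spin_step ⟨i, hi⟩

theorem SchurLabel.isZSpin {n : ℕ} (ℓ : SchurLabel n) : IsZSpin (ℓ.path n) ℓ.z := by
  rw [ℓ.path_eq (by omega)]
  exact ⟨ℓ.abs_z_le, ℓ.even_z⟩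

theorem schurState_eq {n : ℕ} (ℓ : SchurLabel n) : schurState ℓ = schurVec ℓ.path n ℓ.z := by
  ext x
  rw [schurVec_apply, schurState]
  have : ∀ i : Fin n, ℓ.path i = ℓ.spin i.castSucc ∧ ℓ.path (i + 1) = ℓ.spin i.succ :=
    fun i => ⟨ℓ.path_eq _, ℓ.path_eq _⟩
  simp only [this]

theorem SchurLabel.ext_path {n : ℕ} {ℓ ℓ' : SchurLabel n} (h : ∀ i ≤ n, ℓ.path i = ℓ'.path i)
    (hz : ℓ.z = ℓ'.z) : ℓ = ℓ' := by
  have hs : ℓ.spin = ℓ'.spin := by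
    funext i
    have := h i (by omega)
    rwa [ℓ.path_eq i.2, ℓ'.path_eq i.2] at this
  cases ℓ
  cases ℓ'
  simp_all

theorem orthonormal_schurState (n : ℕ) :
    Orthonormal ℂ (schurState : SchurLabel n → QState n) := by
  classical
  rw [orthonormal_iff_ite]
  intro ℓ ℓ'
  rw [schurState_eq, schurState_eq,
    inner_schurVec ℓ.isSpinPath ℓ'.isSpinPath ℓ.isZSpin ℓ'.isZSpin]
  by_cases h : ℓ = ℓ'
  · subst h; simp
  · rw [if_neg h, if_neg fun h' => h (SchurLabel.ext_path h'.1 h'.2)]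

theorem span_schurState (n : ℕ) :
    Submodule.span ℂ (Set.range (schurState : SchurLabel n → QState n)) = ⊤ := by
  rw [eq_top_iff, ← span_schurVecs n]
  refine Submodule.span_mono ?_
  rintro _ ⟨k, z, hk, hz, rfl⟩
  let ℓ : SchurLabel n :=
    { spin := fun i => k i
      spin_zero := hk.1
      spin_step := fun i => hk.2 i i.2
      z := z
      abs_z_le := hz.1
      even_z := hz.2 }
  refine ⟨ℓ, ?_⟩
  rw [schurState_eq]
  exact schurVec_congr (fun i hi => ℓ.path_eq (by omega)) z

theorem schurState_ne_zero {n : ℕ} (ℓ : SchurLabel n) : schurState ℓ ≠ 0 :=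
  (orthonormal_schurState n).ne_zero ℓ

/-! ### The singlet projector on the last two qubits -/

/-- The component along the singlet of the last two qubits. -/
def singletComp {n : ℕ} (v : QState (n + 2)) : QState n :=
  ((√2 : ℝ) : ℂ)⁻¹ • (slice 0 (slice 1 v) - slice 1 (slice 0 v))

theorem slice_slice_singletProj {n : ℕ} (b b' : Fin 2) (v : QState (n + 2)) :
    slice b (slice b' (singletProj (Fin.last n).castSucc (Fin.last (n + 1)) v)) =
      singlet b b' • singletComp v := by
  ext x
  simp only [slice_apply, singletComp, singletProj_apply (Fin.castSucc_lt_last _).ne,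
    PiLp.smul_apply, PiLp.sub_apply, ← Fin.snoc_update, Fin.update_snoc_last, Fin.snoc_last,
    Fin.snoc_castSucc, smul_eq_mul]

theorem singletProj_eq_zero {n : ℕ} {v : QState (n + 2)} (hv : singletComp v = 0) :
    singletProj (Fin.last n).castSucc (Fin.last (n + 1)) v = 0 := by
  refine ext_slice fun b' => ext_slice fun b => ?_
  rw [slice_slice_singletProj, hv, smul_zero, map_zero, map_zero]

theorem sqrt_two_mul (x : ℝ) : √(2 * x) = √2 * √x := Real.sqrt_mul (by norm_num) x

theorem cCoef_up (t : ℕ) :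
    cCoef (t + 1) t (t + 1) = √((t : ℝ) + 1) / √(2 * ((t : ℝ) + 2)) := by
  rw [cCoef, if_pos ⟨rfl, rfl⟩, ← Real.sqrt_div' _ (by positivity)]
  congr 1
  push_cast
  field_simp
  ring

theorem cCoef_down (s : ℕ) :
    cCoef s (s + 1) s = -(√((s : ℝ) + 2) / √(2 * ((s : ℝ) + 1))) := by
  rw [cCoef, if_neg (by omega), if_pos ⟨rfl, rfl⟩, ← Real.sqrt_div' _ (by positivity)]
  congr 2
  field_simp

/-- The singlet is rotation invariant, so the overlap cannot depend on `z` and vanishes unless `k =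
s`; it equals `c(k, j, s)` up to the sign of the convention. -/
theorem cgHalf_singlet {k j s : ℕ} (hkj : j = k + 1 ∨ k = j + 1) (hjs : s = j + 1 ∨ j = s + 1)
    {z : ℤ} (hz : |z| ≤ (s : ℤ)) :
    (√2)⁻¹ * (cgHalf j s z 1 * cgHalf k j (z + 1) 0 - cgHalf j s z 0 * cgHalf k j (z - 1) 1) =
      -cCoef k j s := by
  obtain ⟨h1, h2⟩ := abs_le.mp hz
  have h1' : -(s : ℝ) ≤ z := by exact_mod_cast h1
  have h2' : (z : ℝ) ≤ s := by exact_mod_cast h2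
  rcases hjs with rfl | rfl
  · rcases hkj with rfl | rfl
    · rw [cCoef, if_neg (by omega), if_neg (by omega), cgHalf_up_zero, cgHalf_up_one,
        cgHalf_up_zero, cgHalf_up_one]
      push_cast
      rw [show (k : ℝ) + 1 - (z - 1) = k + 1 + 1 - z by ring,
        show (k : ℝ) + 1 + (z + 1) = k + 1 + 1 + z by ring]
      ring
    · rw [cCoef_up, cgHalf_up_zero, cgHalf_up_one, cgHalf_down_zero, cgHalf_down_one]
      push_cast at h1' h2' ⊢
      rw [show (j : ℝ) + 2 - (z + 1) = j + 1 - z by ring,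
        show (j : ℝ) + 2 + (z - 1) = j + 1 + z by ring]
      have hB : √((j : ℝ) + 1 + z) * √((j : ℝ) + 1 + z) = j + 1 + z :=
        Real.mul_self_sqrt (by linarith)
      have hC : √((j : ℝ) + 1 - z) * √((j : ℝ) + 1 - z) = j + 1 - z :=
        Real.mul_self_sqrt (by linarith)
      have hD : √((j : ℝ) + 1) * √((j : ℝ) + 1) = j + 1 := Real.mul_self_sqrt (by positivity)
      have hpos : 0 < √((j : ℝ) + 1) := by positivity
      have hpos' : 0 < √((j : ℝ) + 2) := by positivity
      rw [sqrt_two_mul, sqrt_two_mul]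
      field_simp
      rw [Real.sq_sqrt (by norm_num : (0 : ℝ) ≤ 2)]
      linear_combination -hB - hC + 2 * hD
  · rcases hkj with h | rfl
    · obtain rfl : s = k := by omega
      rw [cCoef_down, cgHalf_up_zero, cgHalf_up_one, cgHalf_down_zero, cgHalf_down_one]
      push_cast
      rw [show (s : ℝ) + 1 + (z + 1) = s + 2 + z by ring,
        show (s : ℝ) + 1 - (z - 1) = s + 2 - z by ring]
      have hB : √((s : ℝ) + 2 + z) * √((s : ℝ) + 2 + z) = s + 2 + z :=
        Real.mul_self_sqrt (by linarith)
      have hC : √((s : ℝ) + 2 - z) * √((s : ℝ) + 2 - z) = s + 2 - z :=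
        Real.mul_self_sqrt (by linarith)
      have hD : √((s : ℝ) + 2) * √((s : ℝ) + 2) = s + 2 := Real.mul_self_sqrt (by positivity)
      have hpos : 0 < √((s : ℝ) + 1) := by positivity
      have hpos' : 0 < √((s : ℝ) + 2) := by positivity
      rw [sqrt_two_mul, sqrt_two_mul]
      field_simp
      rw [Real.sq_sqrt (by norm_num : (0 : ℝ) ≤ 2)]
      linear_combination hB + hC - 2 * hD
    · rw [cCoef, if_neg (by omega), if_neg (by omega), cgHalf_down_zero, cgHalf_down_one,
        cgHalf_down_zero, cgHalf_down_one]
      push_cast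
      rw [show (s : ℝ) + 1 + 2 - (z + 1) = s + 2 - z by ring,
        show (s : ℝ) + 1 + 2 + (z - 1) = s + 2 + z by ring]
      ring

theorem singletComp_schurVec {k : ℕ → ℕ} {n : ℕ} (hk : IsSpinPath k (n + 2)) {z : ℤ}
    (hz : IsZSpin (k (n + 2)) z) :
    singletComp (schurVec k (n + 2) z) =
      -((cCoef (k n) (k (n + 1)) (k (n + 2)) : ℝ) : ℂ) • schurVec k n z := by
  rw [singletComp, slice_one_schurVec, slice_zero_schurVec, map_smul, map_smul,
    slice_one_schurVec, slice_zero_schurVec, add_sub_cancel_right, sub_add_cancel, smul_smul,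
    smul_smul, ← sub_smul, smul_smul]
  congr 1
  exact_mod_cast cgHalf_singlet (hk.2 n (by omega)) (hk.2 (n + 1) (by omega)) hz.1

theorem singletProj_schurVec_of_ne {k : ℕ → ℕ} {n : ℕ} (hk : IsSpinPath k (n + 2)) {z : ℤ}
    (hz : IsZSpin (k (n + 2)) z) (hne : k n ≠ k (n + 2)) :
    singletProj (Fin.last n).castSucc (Fin.last (n + 1)) (schurVec k (n + 2) z) = 0 := by
  apply singletProj_eq_zero
  rw [singletComp_schurVec hk hz, cCoef, if_neg (by omega), if_neg (by omega)]
  simp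

theorem singlet_eq_ofReal (b b' : Fin 2) :
    singlet b b' = (((if b = 0 ∧ b' = 1 then (√2)⁻¹ else if b = 1 ∧ b' = 0 then -(√2)⁻¹ else 0) : ℝ)
      : ℂ) := by
  rw [singlet]
  split_ifs <;> simp [neg_div]

/-- Amplitudes of the reverse expansion: up to sign, a spin `s` state tensored with the singlet is
the combination of the two couplings with weights `c(s, s ∓ 1/2, s)`. -/
theorem cgHalf_pair (t : ℕ) {z : ℤ} (hz : |z| ≤ (t : ℤ) + 1) (b b' : Fin 2) :
    cCoef (t + 1) t (t + 1) * (cgHalf t (t + 1) z b' * cgHalf (t + 1) t (z - zBit b') b) +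
      cCoef (t + 1) (t + 2) (t + 1) *
        (cgHalf (t + 2) (t + 1) z b' * cgHalf (t + 1) (t + 2) (z - zBit b') b) =
      -(if b = 0 ∧ b' = 1 then (√2)⁻¹ else if b = 1 ∧ b' = 0 then -(√2)⁻¹ else 0) := by
  obtain ⟨h1, h2⟩ := abs_le.mp hz
  have h1' : -((t : ℝ) + 1) ≤ z := by exact_mod_cast h1
  have h2' : (z : ℝ) ≤ t + 1 := by exact_mod_cast h2
  have e2 : √(2 : ℝ) ^ 2 = 2 := Real.sq_sqrt (by norm_num)
  have hc := cCoef_down (t + 1)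
  have hu0 := cgHalf_up_zero (t + 1)
  have hu1 := cgHalf_up_one (t + 1)
  have hd0 := cgHalf_down_zero (t + 1)
  have hd1 := cgHalf_down_one (t + 1)
  have p1 : 0 < √((t : ℝ) + 1) := by positivity
  have p2 : 0 < √((t : ℝ) + 2) := by positivity
  have p3 : 0 < √((t : ℝ) + 3) := by positivity
  have q2 : √((t : ℝ) + 2) ^ 2 = t + 2 := Real.sq_sqrt (by positivity)
  have r1 : √((t : ℝ) + 1 + z) ^ 2 = t + 1 + z := Real.sq_sqrt (by linarith)
  have r2 : √((t : ℝ) + 1 - z) ^ 2 = t + 1 - z := Real.sq_sqrt (by linarith)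
  have r3 : √((t : ℝ) + 3 + z) ^ 2 = t + 3 + z := Real.sq_sqrt (by linarith)
  have r4 : √((t : ℝ) + 3 - z) ^ 2 = t + 3 - z := Real.sq_sqrt (by linarith)
  obtain ⟨rfl, hb⟩ | ⟨rfl, hb⟩ : b = 0 ∧ zBit b = 1 ∨ b = 1 ∧ zBit b = -1 := by
    fin_cases b <;> simp [zBit]
  all_goals
    obtain ⟨rfl, hb'⟩ | ⟨rfl, hb'⟩ : b' = 0 ∧ zBit b' = 1 ∨ b' = 1 ∧ zBit b' = -1 := by
      fin_cases b' <;> simp [zBit]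
    all_goals
      rw [hb', cCoef_up, hc]
      simp only [hu0, hu1, hd0, hd1, cgHalf_up_zero, cgHalf_up_one, cgHalf_down_zero,
        cgHalf_down_one]
      push_cast
      simp only [show (t : ℝ) + 1 + 1 = t + 2 by ring, show (t : ℝ) + 1 + 2 = t + 3 by ring,
        show (t : ℝ) + 2 - (z - 1) = t + 3 - z by ring,
        show (t : ℝ) + 2 + (z - 1) = t + 1 + z by ring,
        show (t : ℝ) + 2 - (z - -1) = t + 1 - z by ring,
        show (t : ℝ) + 2 + (z - -1) = t + 3 + z by ring, sqrt_two_mul]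
      simp
      field_simp
  -- Equal bits cancel identically; opposite bits use the squares of the roots and leave `±1/√2`.
  · ring
  · rw [r2, r3, e2, q2]
    ring
  · rw [r1, r4, e2, q2]
    ring
  · ring

/-- The block of the projector is the outer product of `(c(s, s - 1/2, s), c(s, s + 1/2, s))` with
itself: `cgHalf_singlet` supplies the overlap and `cgHalf_pair` the vector projected onto. -/
theorem singletProj_schurVec_pair {k₁ k₂ k : ℕ → ℕ} {n t : ℕ} (hk₁ : IsSpinPath k₁ (n + 2))
    (hk₂ : IsSpinPath k₂ (n + 2)) {z : ℤ} (hz : IsZSpin (k (n + 2)) z)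
    (h₁ : ∀ i ≤ n + 2, i ≠ n + 1 → k₁ i = k i) (h₂ : ∀ i ≤ n + 2, i ≠ n + 1 → k₂ i = k i)
    (hn : k n = t + 1) (hs : k (n + 2) = t + 1) (hj₁ : k₁ (n + 1) = t) (hj₂ : k₂ (n + 1) = t + 2) :
    singletProj (Fin.last n).castSucc (Fin.last (n + 1)) (schurVec k₁ (n + 2) z) =
        ((cCoef (t + 1) t (t + 1) : ℝ) : ℂ) •
          (((cCoef (t + 1) t (t + 1) : ℝ) : ℂ) • schurVec k₁ (n + 2) z +
            ((cCoef (t + 1) (t + 2) (t + 1) : ℝ) : ℂ) • schurVec k₂ (n + 2) z) ∧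
      singletProj (Fin.last n).castSucc (Fin.last (n + 1)) (schurVec k₂ (n + 2) z) =
        ((cCoef (t + 1) (t + 2) (t + 1) : ℝ) : ℂ) •
          (((cCoef (t + 1) t (t + 1) : ℝ) : ℂ) • schurVec k₁ (n + 2) z +
            ((cCoef (t + 1) (t + 2) (t + 1) : ℝ) : ℂ) • schurVec k₂ (n + 2) z) := by
  have hn₁ := (h₁ n (by omega) (by omega)).trans hn
  have hn₂ := (h₂ n (by omega) (by omega)).trans hn
  have hs₁ := (h₁ (n + 2) (by omega) (by omega)).trans hs
  have hs₂ := (h₂ (n + 2) (by omega) (by omega)).trans hs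
  have hv₁ : ∀ y, schurVec k₁ n y = schurVec k n y :=
    schurVec_congr fun i hi => h₁ i (by omega) (by omega)
  have hv₂ : ∀ y, schurVec k₂ n y = schurVec k n y :=
    schurVec_congr fun i hi => h₂ i (by omega) (by omega)
  have habs : |z| ≤ (t : ℤ) + 1 := by
    have := hz.1
    rw [hs] at this
    exact_mod_cast this
  have key : ∀ b b' : Fin 2, slice b (slice b'
      (((cCoef (t + 1) t (t + 1) : ℝ) : ℂ) • schurVec k₁ (n + 2) z +
        ((cCoef (t + 1) (t + 2) (t + 1) : ℝ) : ℂ) • schurVec k₂ (n + 2) z)) =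
      -singlet b b' • schurVec k n z := by
    intro b b'
    -- The singlet amplitude vanishes unless the bits are opposite, and then the two shifts of `z`
    -- cancel.
    have hzz : singlet b b' • schurVec k n z = singlet b b' • schurVec k n (z - zBit b' - zBit b) := by
      obtain rfl | rfl : b = 0 ∨ b = 1 := by fin_cases b <;> simp
      all_goals
        obtain rfl | rfl : b' = 0 ∨ b' = 1 := by fin_cases b' <;> simp
        all_goals simp [singlet, zBit]
    rw [neg_smul, hzz, ← neg_smul, map_add, map_smul, map_smul, slice_schurVec, slice_schurVec,
      map_add, map_smul, map_smul, map_smul, map_smul, slice_schurVec, slice_schurVec, hn₁, hn₂, hs₁,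
      hs₂, hj₁, hj₂, hv₁, hv₂, smul_smul, smul_smul, smul_smul, smul_smul, ← add_smul,
      singlet_eq_ofReal, ← Complex.ofReal_neg, ← cgHalf_pair t habs]
    congr 1
    push_cast
    ring
  constructor <;> refine ext_slice fun b' => ext_slice fun b => ?_
  · rw [slice_slice_singletProj, singletComp_schurVec hk₁ (by rwa [hs₁, ← hs]), map_smul, map_smul,
      key, hn₁, hs₁, hj₁, hv₁, smul_smul, smul_smul]
    congr 1
    ring
  · rw [slice_slice_singletProj, singletComp_schurVec hk₂ (by rwa [hs₂, ← hs]), map_smul, map_smul,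
      key, hn₂, hs₂, hj₂, hv₂, smul_smul, smul_smul]
    congr 1
    ring

theorem cCoef_zero_one_zero : cCoef 0 1 0 = -1 := by
  have := cCoef_down 0
  norm_num at this
  exact this

/-- For `s = 0` the intermediate spin must be `1/2`, so the block is one-dimensional and the state
already is a singlet on the last two qubits. -/
theorem singletProj_schurVec_zero {k : ℕ → ℕ} {n : ℕ} (hk : IsSpinPath k (n + 2)) {z : ℤ}
    (hz : IsZSpin (k (n + 2)) z) (hn : k n = 0) (hs : k (n + 2) = 0) :
    singletProj (Fin.last n).castSucc (Fin.last (n + 1)) (schurVec k (n + 2) z) =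
      schurVec k (n + 2) z := by
  have hj : k (n + 1) = 1 := by
    have := hk.2 n (by omega)
    omega
  have hz0 : z = 0 := by simpa [IsZSpin, hs] using hz.1
  refine ext_slice fun b' => ext_slice fun b => ?_
  rw [slice_slice_singletProj, singletComp_schurVec hk hz, slice_schurVec, map_smul,
    slice_schurVec, hn, hs, hj, hz0, cCoef_zero_one_zero, singlet_eq_ofReal]
  obtain rfl | rfl : b = 0 ∨ b = 1 := by fin_cases b <;> simp
  all_goals
    obtain rfl | rfl : b' = 0 ∨ b' = 1 := by fin_cases b' <;> simp
    all_goals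
      simp [zBit, cgHalf]
      try norm_num

/-! ### The measurement operators on the Schur states -/

theorem hCoef_pos (N : ℕ) : 0 < hCoef N := by
  unfold hCoef
  positivity

theorem gCoef_pos (N d : ℕ) : 0 < gCoef N d := by
  unfold gCoef
  have := Nat.factorial_pos N
  have := Nat.factorial_pos ((N - d) / 2)
  have := Nat.factorial_pos ((N + d) / 2 + 1)
  positivity

theorem nu_pos (N d : ℕ) : 0 < nu N d := by
  unfold nu
  have := hCoef_pos N
  have := gCoef_pos N d
  positivity

theorem uCoef_pos {N : ℕ} (hN : 1 ≤ N) (d : ℕ) : 0 < uCoef N d := by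
  unfold uCoef
  have := hCoef_pos N
  have := gCoef_pos (N - 1) d
  have : (0 : ℝ) < N := by exact_mod_cast hN
  positivity

theorem del_ne_zero (N s : ℕ) : del N s ≠ 0 := by
  have h1 : (0 : ℝ) < √(nu N (s + 1)) := Real.sqrt_pos.mpr (nu_pos _ _)
  have h2 : (0 : ℝ) < √((s : ℝ) + 2) / √(2 * ((s : ℝ) + 1)) := by positivity
  rw [del, cCoef_down]
  exact div_ne_zero (neg_ne_zero.mpr h2.ne') h1.ne'

theorem gam_sq_add_del_sq_pos (N s : ℕ) : 0 < gam N s ^ 2 + del N s ^ 2 := by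
  have := del_ne_zero N s
  positivity

theorem ports_eq (N : ℕ) : ports N = Finset.univ.filter fun q : Fin (N + 1) => (q : ℕ) < N := by
  ext q
  have := q.2
  simp only [ports, Finset.mem_erase, Finset.mem_univ, and_true, Finset.mem_filter, true_and, ne_eq,
    Fin.ext_iff, Fin.val_last]
  omega

theorem ports_erase_last (n : ℕ) :
    (ports (n + 1)).erase (Fin.last n).castSucc =
      Finset.univ.filter fun q : Fin (n + 2) => (q : ℕ) < n := by
  ext q
  have := q.2
  simp only [ports, Finset.mem_erase, Finset.mem_univ, and_true, Finset.mem_filter, true_and, ne_eq,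
    Fin.ext_iff, Fin.val_last, Fin.val_castSucc]
  omega

theorem opO_schurVec {k : ℕ → ℕ} {N : ℕ} (hk : IsSpinPath k (N + 1)) (z : ℤ) :
    opO N (schurVec k (N + 1) z) = ((√(nu N (k N)) : ℝ) : ℂ) • schurVec k (N + 1) z := by
  rw [opO, ports_eq, sum_smul_spinProj_apply (totalSpin_initial_schurVec hk z (by omega)),
    if_pos hk.of_succ.mem_spins]

/-- All `√ν(j)` are nonzero, so the range contains the spanning Schur vectors; in finite dimension
surjectivity suffices. -/
theorem isUnit_opO (N : ℕ) : IsUnit (opO N) := by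
  rw [LinearMap.isUnit_iff_range_eq_top, eq_top_iff, ← span_schurVecs, Submodule.span_le]
  rintro _ ⟨k, z, hk, -, rfl⟩
  have h : ((√(nu N (k N)) : ℝ) : ℂ) ≠ 0 := by
    exact_mod_cast (Real.sqrt_pos.mpr (nu_pos _ _)).ne'
  refine ⟨((√(nu N (k N)) : ℝ) : ℂ)⁻¹ • schurVec k (N + 1) z, ?_⟩
  rw [map_smul, opO_schurVec hk, smul_smul, inv_mul_cancel₀ h, one_smul]

theorem inverse_opO_schurVec {k : ℕ → ℕ} {N : ℕ} (hk : IsSpinPath k (N + 1)) (z : ℤ) :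
    Ring.inverse (opO N) (schurVec k (N + 1) z) =
      ((√(nu N (k N)) : ℝ) : ℂ)⁻¹ • schurVec k (N + 1) z := by
  have h : ((√(nu N (k N)) : ℝ) : ℂ) ≠ 0 := by
    exact_mod_cast (Real.sqrt_pos.mpr (nu_pos _ _)).ne'
  have h1 := LinearMap.congr_fun (Ring.inverse_mul_cancel _ (isUnit_opO N)) (schurVec k (N + 1) z)
  rw [Module.End.mul_apply, opO_schurVec hk, map_smul, Module.End.one_apply] at h1
  conv_rhs => rw [← h1]
  rw [smul_smul, inv_mul_cancel₀ h, one_smul]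

theorem opTheta_last_schurVec {k : ℕ → ℕ} {n : ℕ} (hk : IsSpinPath k (n + 2)) (z : ℤ) :
    opTheta (n + 1) (Fin.last n) (schurVec k (n + 2) z) =
      ((uCoef (n + 1) (k n) : ℝ) : ℂ) • schurVec k (n + 2) z := by
  rw [opTheta, ports_erase_last,
    sum_smul_spinProj_apply (totalSpin_initial_schurVec hk z (by omega)), Nat.add_sub_cancel,
    if_pos hk.of_succ.of_succ.mem_spins]

theorem povm_last_schurVec {k : ℕ → ℕ} {n : ℕ} (hk : IsSpinPath k (n + 2)) (z : ℤ) :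
    povm (n + 1) (Fin.last n) (schurVec k (n + 2) z) =
      (((√(nu (n + 1) (k (n + 1))) : ℝ) : ℂ)⁻¹ * ((uCoef (n + 1) (k n) : ℝ) : ℂ)) •
        Ring.inverse (opO (n + 1)) (singletProj (Fin.last n).castSucc (Fin.last (n + 1))
          (schurVec k (n + 2) z)) := by
  simp only [povm, Module.End.mul_apply]
  rw [inverse_opO_schurVec hk, map_smul, opTheta_last_schurVec hk, map_smul, map_smul, map_smul,
    map_smul, smul_smul]

theorem povm_last_schurVec_of_ne {k : ℕ → ℕ} {n : ℕ} (hk : IsSpinPath k (n + 2)) {z : ℤ}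
    (hz : IsZSpin (k (n + 2)) z) (hne : k n ≠ k (n + 2)) :
    povm (n + 1) (Fin.last n) (schurVec k (n + 2) z) = 0 := by
  rw [povm_last_schurVec hk, singletProj_schurVec_of_ne hk hz hne, map_zero, smul_zero]

/-- The two inverses of `O_A` divide each `c(s, j, s)` by `√ν(j)`, which is how `γ` and `δ` arise;
`Θ̃_N` contributes the scalar `u(s)`. -/
theorem povm_last_schurVec_pair {k₁ k₂ k : ℕ → ℕ} {n t : ℕ} (hk₁ : IsSpinPath k₁ (n + 2))
    (hk₂ : IsSpinPath k₂ (n + 2)) {z : ℤ} (hz : IsZSpin (k (n + 2)) z)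
    (h₁ : ∀ i ≤ n + 2, i ≠ n + 1 → k₁ i = k i) (h₂ : ∀ i ≤ n + 2, i ≠ n + 1 → k₂ i = k i)
    (hn : k n = t + 1) (hs : k (n + 2) = t + 1) (hj₁ : k₁ (n + 1) = t) (hj₂ : k₂ (n + 1) = t + 2) :
    povm (n + 1) (Fin.last n) (schurVec k₁ (n + 2) z) =
        ((uCoef (n + 1) (t + 1) * gam (n + 1) (t + 1) : ℝ) : ℂ) •
          (((gam (n + 1) (t + 1) : ℝ) : ℂ) • schurVec k₁ (n + 2) z +
            ((del (n + 1) (t + 1) : ℝ) : ℂ) • schurVec k₂ (n + 2) z) ∧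
      povm (n + 1) (Fin.last n) (schurVec k₂ (n + 2) z) =
        ((uCoef (n + 1) (t + 1) * del (n + 1) (t + 1) : ℝ) : ℂ) •
          (((gam (n + 1) (t + 1) : ℝ) : ℂ) • schurVec k₁ (n + 2) z +
            ((del (n + 1) (t + 1) : ℝ) : ℂ) • schurVec k₂ (n + 2) z) := by
  obtain ⟨e₁, e₂⟩ := singletProj_schurVec_pair hk₁ hk₂ hz h₁ h₂ hn hs hj₁ hj₂
  have hn₁ := (h₁ n (by omega) (by omega)).trans hn
  have hn₂ := (h₂ n (by omega) (by omega)).trans hn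
  constructor
  · rw [povm_last_schurVec hk₁, e₁, map_smul, map_add, map_smul, map_smul,
      inverse_opO_schurVec hk₁, inverse_opO_schurVec hk₂, hj₁, hj₂, hn₁, gam, del,
      Nat.add_sub_cancel]
    push_cast
    module
  · rw [povm_last_schurVec hk₂, e₂, map_smul, map_add, map_smul, map_smul,
      inverse_opO_schurVec hk₁, inverse_opO_schurVec hk₂, hj₁, hj₂, hn₂, gam, del,
      Nat.add_sub_cancel]
    push_cast
    module

theorem povm_last_schurVec_zero {k : ℕ → ℕ} {n : ℕ} (hk : IsSpinPath k (n + 2)) {z : ℤ}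
    (hz : IsZSpin (k (n + 2)) z) (hn : k n = 0) (hs : k (n + 2) = 0) :
    povm (n + 1) (Fin.last n) (schurVec k (n + 2) z) =
      ((uCoef (n + 1) 0 * (gam (n + 1) 0 ^ 2 + del (n + 1) 0 ^ 2) : ℝ) : ℂ) •
        schurVec k (n + 2) z := by
  have hj : k (n + 1) = 1 := by
    have := hk.2 n (by omega)
    omega
  -- Here `0 - 1` truncates to `0`, and `cCoef 0 0 0` falls into the default branch `0`.
  have hg : gam (n + 1) 0 = 0 := by simp [gam, cCoef]
  have hd : del (n + 1) 0 = -(√(nu (n + 1) 1))⁻¹ := by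
    rw [del, zero_add, cCoef_zero_one_zero, neg_div, one_div]
  rw [povm_last_schurVec hk, singletProj_schurVec_zero hk hz hn hs, inverse_opO_schurVec hk, hn, hj,
    smul_smul, hg, hd]
  congr 1
  push_cast
  ring

/-! ### Exchanging ports -/

theorem map_swap_ports (N : ℕ) (i j : Fin N) :
    (ports N).map (Equiv.swap i.castSucc j.castSucc).toEmbedding = ports N := by
  rw [ports, Finset.map_erase, Finset.map_univ_equiv, Equiv.toEmbedding_apply,
    Equiv.swap_apply_of_ne_of_ne (Fin.castSucc_lt_last i).ne' (Fin.castSucc_lt_last j).ne']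

theorem map_swap_ports_erase (N : ℕ) (i j : Fin N) :
    ((ports N).erase j.castSucc).map (Equiv.swap i.castSucc j.castSucc).toEmbedding =
      (ports N).erase i.castSucc := by
  rw [Finset.map_erase, map_swap_ports, Equiv.toEmbedding_apply, Equiv.swap_apply_right]

theorem swapOp_conj_sum_spinProj {n : ℕ} (p q : Fin n) (a : Finset (Fin n)) (D : Finset ℕ)
    (f : ℕ → ℂ) :
    ∑ d ∈ D, f d • spinProj (a.map (Equiv.swap p q).toEmbedding) d =
      swapOp p q * (∑ d ∈ D, f d • spinProj a d) * swapOp p q := by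
  simp only [Finset.mul_sum, Finset.sum_mul, spinProj_map_swap, mul_smul_comm, smul_mul_assoc]

theorem swapOp_conj_opTheta (N : ℕ) (i j : Fin N) :
    opTheta N i =
      swapOp i.castSucc j.castSucc * opTheta N j * swapOp i.castSucc j.castSucc := by
  rw [opTheta, opTheta, ← swapOp_conj_sum_spinProj, map_swap_ports_erase]

theorem swapOp_commute_opO (N : ℕ) (i j : Fin N) :
    Commute (swapOp i.castSucc j.castSucc) (opO N) := by
  have h : opO N = swapOp i.castSucc j.castSucc * opO N * swapOp i.castSucc j.castSucc := by
    conv_lhs => rw [opO, ← map_swap_ports N i j, swapOp_conj_sum_spinProj]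
    rfl
  have h' : opO N * swapOp i.castSucc j.castSucc = swapOp i.castSucc j.castSucc * opO N := by
    conv_lhs => rw [h]
    rw [mul_assoc, swapOp_mul_self, mul_one]
  exact h'.symm

theorem swapOp_commute_inverse_opO (N : ℕ) (i j : Fin N) :
    Commute (swapOp i.castSucc j.castSucc) (Ring.inverse (opO N)) := by
  obtain ⟨U, hU⟩ := isUnit_opO N
  have h := swapOp_commute_opO N i j
  rw [← hU] at h ⊢
  rw [Ring.inverse_unit]
  exact h.units_inv_right

/-- The exchange commutes with `O_A⁻¹`, as it maps the set of ports to itself, and it conjugates the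
singlet projector and `Θ̃` for port `j` into those for port `i`. -/
theorem swapOp_conj_povm (N : ℕ) (i j : Fin N) :
    povm N i = swapOp i.castSucc j.castSucc * povm N j * swapOp i.castSucc j.castSucc := by
  have hc := swapOp_commute_inverse_opO N i j
  have hw := swapOp_mul_self i.castSucc j.castSucc
  rw [povm, povm, swapOp_conj_singletProj i.castSucc j.castSucc (Fin.last N)
    (Fin.castSucc_lt_last i).ne (Fin.castSucc_lt_last j).ne, swapOp_conj_opTheta N i j]
  generalize swapOp i.castSucc j.castSucc = W at *
  generalize Ring.inverse (opO N) = R at *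
  generalize singletProj j.castSucc (Fin.last N) = P
  generalize opTheta N j = T
  calc R * (W * P * W * (W * T * W)) * R = (R * W) * P * (W * W) * T * (W * R) := by
        simp only [mul_assoc]
    _ = W * (R * (P * T) * R) * W := by
        rw [hw, mul_one, hc.eq, ← hc.eq]
        nth_rw 2 [hc.eq]
        simp only [mul_assoc]

/-- Where the singlet projector does not vanish, the spin of the first `n` qubits equals the total
spin, so either one may be the argument of `u`. -/
theorem singletProj_mul_opTheta_last (n : ℕ) :
    singletProj (Fin.last n).castSucc (Fin.last (n + 1)) * opTheta (n + 1) (Fin.last n) =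
      singletProj (Fin.last n).castSucc (Fin.last (n + 1)) *
        ∑ d ∈ spins n, ((uCoef (n + 1) d : ℝ) : ℂ) • spinProj Finset.univ d := by
  refine ext_schurVec fun k z hk hz => ?_
  rw [Module.End.mul_apply, Module.End.mul_apply, opTheta_last_schurVec hk,
    sum_smul_spinProj_apply (totalSpin_univ_schurVec hk z)]
  by_cases h : k n = k (n + 2)
  · rw [← h, if_pos hk.of_succ.of_succ.mem_spins]
  · rw [map_smul, singletProj_schurVec_of_ne hk hz h, smul_zero]
    split_ifs
    · rw [map_smul, singletProj_schurVec_of_ne hk hz h, smul_zero]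
    · rw [map_zero]

/-- The total spin of all the qubits is invariant under exchanges, so the right-hand factor is
independent of `i` and can be pulled out of the sum over the ports. -/
theorem singletProj_mul_opTheta (n : ℕ) (i : Fin (n + 1)) :
    singletProj i.castSucc (Fin.last (n + 1)) * opTheta (n + 1) i =
      singletProj i.castSucc (Fin.last (n + 1)) *
        ∑ d ∈ spins n, ((uCoef (n + 1) d : ℝ) : ℂ) • spinProj Finset.univ d := by
  have hU := swapOp_conj_sum_spinProj i.castSucc (Fin.last n).castSucc Finset.univ (spins n)
    fun d => ((uCoef (n + 1) d : ℝ) : ℂ)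
  rw [Finset.map_univ_equiv] at hU
  have hw := swapOp_mul_self i.castSucc (Fin.last n).castSucc
  have hl := singletProj_mul_opTheta_last n
  rw [swapOp_conj_singletProj i.castSucc (Fin.last n).castSucc (Fin.last (n + 1))
    (Fin.castSucc_lt_last i).ne (Fin.castSucc_lt_last _).ne,
    swapOp_conj_opTheta (n + 1) i (Fin.last n), hU]
  generalize swapOp i.castSucc (Fin.last n).castSucc = W at *
  calc _ = W * singletProj (Fin.last n).castSucc (Fin.last (n + 1)) * (W * W) *
        opTheta (n + 1) (Fin.last n) * W := by simp only [mul_assoc]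
    _ = W * (singletProj (Fin.last n).castSucc (Fin.last (n + 1)) *
        opTheta (n + 1) (Fin.last n)) * W := by rw [hw, mul_one]; simp only [mul_assoc]
    _ = W * singletProj (Fin.last n).castSucc (Fin.last (n + 1)) * (W * W) *
        (∑ d ∈ spins n, ((uCoef (n + 1) d : ℝ) : ℂ) • spinProj Finset.univ d) * W := by
          rw [hl, hw, mul_one]; simp only [mul_assoc]
    _ = _ := by simp only [mul_assoc]

/-! ### The failure operator -/

theorem sum_singletProj_schurVec {k : ℕ → ℕ} {n : ℕ} (hk : IsSpinPath k (n + 2)) (z : ℤ) :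
    (∑ i : Fin (n + 1), singletProj i.castSucc (Fin.last (n + 1))) (schurVec k (n + 2) z) =
      ((2 ^ n * lam (n + 1) (k (n + 1)) (k (n + 2)) : ℝ) : ℂ) • schurVec k (n + 2) z := by
  rw [sum_singletProj, LinearMap.sub_apply, LinearMap.smul_apply, LinearMap.smul_apply,
    LinearMap.sub_apply, totalSpin_univ_schurVec hk, ports_eq,
    totalSpin_initial_schurVec hk z (by omega), Module.End.one_apply, ← sub_smul, smul_smul,
    ← sub_smul]
  congr 1
  have h2 : (2 : ℂ) ^ n ≠ 0 := pow_ne_zero _ two_ne_zero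
  have hstep : k (n + 2) = k (n + 1) + 1 ∨ k (n + 1) = k (n + 2) + 1 := hk.2 (n + 1) (by omega)
  rcases hstep with h | h
  · rw [lam, if_pos h, h]
    push_cast
    field_simp
    ring
  · rw [lam, if_neg (by omega), if_pos h, h]
    push_cast
    field_simp
    ring

/-- The `else` branch is the maximal total spin, which is not among the spins of `n` qubits and is
therefore annihilated by the common factor replacing `Θ̃_i`. -/
theorem povmFail_schurVec {k : ℕ → ℕ} {n : ℕ} (hk : IsSpinPath k (n + 2)) (z : ℤ) :
    povmFail (n + 1) (schurVec k (n + 2) z) =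
      ((1 - (if k (n + 2) ∈ spins n then 2 ^ n * lam (n + 1) (k (n + 1)) (k (n + 2)) *
        uCoef (n + 1) (k (n + 2)) / nu (n + 1) (k (n + 1)) else 0) : ℝ) : ℂ) •
        schurVec k (n + 2) z := by
  have hsum : ∑ i : Fin (n + 1), povm (n + 1) i = Ring.inverse (opO (n + 1)) *
      ((∑ i : Fin (n + 1), singletProj i.castSucc (Fin.last (n + 1))) *
        ∑ d ∈ spins n, ((uCoef (n + 1) d : ℝ) : ℂ) • spinProj Finset.univ d) *
          Ring.inverse (opO (n + 1)) := by
    rw [Finset.sum_mul, Finset.mul_sum, Finset.sum_mul]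
    refine Finset.sum_congr rfl fun i _ => ?_
    rw [povm, singletProj_mul_opTheta]
  have hnu : ((√(nu (n + 1) (k (n + 1))) : ℝ) : ℂ)⁻¹ * ((√(nu (n + 1) (k (n + 1))) : ℝ) : ℂ)⁻¹ =
      ((nu (n + 1) (k (n + 1)) : ℝ) : ℂ)⁻¹ := by
    rw [← mul_inv, ← Complex.ofReal_mul, Real.mul_self_sqrt (nu_pos _ _).le]
  rw [povmFail, hsum, LinearMap.sub_apply, Module.End.one_apply, Module.End.mul_apply,
    Module.End.mul_apply, Module.End.mul_apply, inverse_opO_schurVec hk, map_smul,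
    sum_smul_spinProj_apply (totalSpin_univ_schurVec hk z)]
  split_ifs
  · rw [map_smul, map_smul, map_smul, map_smul, sum_singletProj_schurVec hk, map_smul,
      inverse_opO_schurVec hk]
    match_scalars
    linear_combination (-(uCoef (n + 1) (k (n + 2)) : ℂ) * 2 ^ n *
      (lam (n + 1) (k (n + 1)) (k (n + 2)) : ℂ)) * hnu
  · simp

/-! ### Eigenvectors in terms of Schur labels -/

theorem add_smul_schurState_ne_zero {n : ℕ} {ℓ ℓ' : SchurLabel n} (h : ℓ ≠ ℓ') {a : ℂ}
    (ha : a ≠ 0) (b : ℂ) : a • schurState ℓ + b • schurState ℓ' ≠ 0 := by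
  classical
  intro h0
  have ho := orthonormal_iff_ite.mp (orthonormal_schurState n)
  have h1 : inner ℂ (schurState ℓ) (a • schurState ℓ + b • schurState ℓ') = a := by
    rw [inner_add_right, inner_smul_right, inner_smul_right, ho, ho, if_pos rfl, if_neg h]
    ring
  rw [h0, inner_zero_right] at h1
  exact ha h1.symm

theorem totalSpin_initial_schurState {n : ℕ} (ℓ : SchurLabel n) (i : Fin (n + 1)) :
    totalSpin (Finset.univ.filter fun q : Fin n => (q : ℕ) < (i : ℕ)) (schurState ℓ) =
      ((ℓ.spin i : ℂ) / 2 * ((ℓ.spin i : ℂ) / 2 + 1)) • schurState ℓ := by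
  rw [schurState_eq, totalSpin_initial_schurVec ℓ.isSpinPath _ (by omega), ℓ.path_eq i.2]

theorem kSpin_eq {n : ℕ} (ℓ : SchurLabel (n + 2)) :
    SchurLabel.kSpin (N := n + 1) ℓ = ℓ.path n := (ℓ.path_eq (by omega)).symm

theorem jSpin_eq {n : ℕ} (ℓ : SchurLabel (n + 2)) :
    SchurLabel.jSpin (N := n + 1) ℓ = ℓ.path (n + 1) := (ℓ.path_eq (by omega)).symm

theorem sSpin_eq {n : ℕ} (ℓ : SchurLabel (n + 2)) :
    SchurLabel.sSpin (N := n + 1) ℓ = ℓ.path (n + 2) := (ℓ.path_eq (by omega)).symm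

theorem povm_last_hasEigenvector_of_ne {n : ℕ} (ℓ : SchurLabel (n + 2))
    (h : ℓ.path n ≠ ℓ.path (n + 2)) :
    Module.End.HasEigenvector (povm (n + 1) (Fin.last n)) 0 (schurState ℓ) := by
  rw [Module.End.hasEigenvector_iff, Module.End.mem_eigenspace_iff]
  refine ⟨?_, schurState_ne_zero ℓ⟩
  rw [schurState_eq, povm_last_schurVec_of_ne ℓ.isSpinPath ℓ.isZSpin h, zero_smul]

/-- A multiple of the outer product of `(γ, δ)` with itself annihilates `(δ, -γ)` and scales `(γ,
δ)` by its squared length; normalisation plays no role in either equation. -/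
theorem povm_last_hasEigenvector_pair {n t : ℕ} (ℓ₁ ℓ₂ : SchurLabel (n + 2))
    (hp : ∀ i ≤ n + 2, i ≠ n + 1 → ℓ₁.path i = ℓ₂.path i) (hz : ℓ₁.z = ℓ₂.z)
    (hn : ℓ₁.path n = t + 1) (hs : ℓ₁.path (n + 2) = t + 1) (hj₁ : ℓ₁.path (n + 1) = t)
    (hj₂ : ℓ₂.path (n + 1) = t + 2) :
    Module.End.HasEigenvector (povm (n + 1) (Fin.last n)) 0
        (((del (n + 1) (t + 1) /
            √(gam (n + 1) (t + 1) ^ 2 + del (n + 1) (t + 1) ^ 2) : ℝ) : ℂ) • schurState ℓ₁ -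
          ((gam (n + 1) (t + 1) /
            √(gam (n + 1) (t + 1) ^ 2 + del (n + 1) (t + 1) ^ 2) : ℝ) : ℂ) • schurState ℓ₂) ∧
      Module.End.HasEigenvector (povm (n + 1) (Fin.last n))
        ((uCoef (n + 1) (t + 1) *
          (gam (n + 1) (t + 1) ^ 2 + del (n + 1) (t + 1) ^ 2) : ℝ) : ℂ)
        (((gam (n + 1) (t + 1) /
            √(gam (n + 1) (t + 1) ^ 2 + del (n + 1) (t + 1) ^ 2) : ℝ) : ℂ) • schurState ℓ₁ +
          ((del (n + 1) (t + 1) /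
            √(gam (n + 1) (t + 1) ^ 2 + del (n + 1) (t + 1) ^ 2) : ℝ) : ℂ) • schurState ℓ₂) := by
  obtain ⟨e₁, e₂⟩ := povm_last_schurVec_pair ℓ₁.isSpinPath ℓ₂.isSpinPath ℓ₁.isZSpin
    (fun _ _ _ => rfl) (fun i hi hi' => (hp i hi hi').symm) hn hs hj₁ hj₂
  rw [← schurState_eq, hz, ← schurState_eq] at e₁ e₂
  have hne : ℓ₁ ≠ ℓ₂ := by
    rintro rfl
    omega
  have hr : ((del (n + 1) (t + 1) /
      √(gam (n + 1) (t + 1) ^ 2 + del (n + 1) (t + 1) ^ 2) : ℝ) : ℂ) ≠ 0 := by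
    rw [Complex.ofReal_ne_zero]
    exact div_ne_zero (del_ne_zero _ _) (Real.sqrt_pos.mpr (gam_sq_add_del_sq_pos _ _)).ne'
  rw [Module.End.hasEigenvector_iff, Module.End.mem_eigenspace_iff, Module.End.hasEigenvector_iff,
    Module.End.mem_eigenspace_iff]
  refine ⟨⟨?_, ?_⟩, ?_, ?_⟩
  · rw [map_sub, map_smul, map_smul, e₁, e₂]
    push_cast
    module
  · rw [sub_eq_add_neg, ← neg_smul]
    exact add_smul_schurState_ne_zero hne hr _
  · rw [map_add, map_smul, map_smul, e₁, e₂]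
    push_cast
    module
  -- The coefficient known to be nonzero is the one with `δ`, so it is moved to the front.
  · rw [add_comm (_ • schurState ℓ₁)]
    exact add_smul_schurState_ne_zero hne.symm hr _

theorem povm_last_hasEigenvector_zero {n : ℕ} (ℓ : SchurLabel (n + 2)) (hn : ℓ.path n = 0)
    (hs : ℓ.path (n + 2) = 0) :
    Module.End.HasEigenvector (povm (n + 1) (Fin.last n))
      ((uCoef (n + 1) 0 * (gam (n + 1) 0 ^ 2 + del (n + 1) 0 ^ 2) : ℝ) : ℂ) (schurState ℓ) := by
  rw [Module.End.hasEigenvector_iff, Module.End.mem_eigenspace_iff]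
  refine ⟨?_, schurState_ne_zero ℓ⟩
  rw [schurState_eq, povm_last_schurVec_zero ℓ.isSpinPath ℓ.isZSpin hn hs]

/-- An involution `W` is injective and satisfies `W T W (W v) = W (T v)`. -/
theorem hasEigenvector_conj_iff {E : Type*} [AddCommGroup E] [Module ℂ E] {T T' W : Module.End ℂ E}
    (hW : W * W = 1) (hT : T' = W * T * W) (μ : ℂ) (v : E) :
    Module.End.HasEigenvector T μ v ↔ Module.End.HasEigenvector T' μ (W v) := by
  have hWW : ∀ w, W (W w) = w := fun w => by rw [← Module.End.mul_apply, hW, Module.End.one_apply]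
  have hinj : Function.Injective W := Function.LeftInverse.injective hWW
  rw [Module.End.hasEigenvector_iff, Module.End.mem_eigenspace_iff, Module.End.hasEigenvector_iff,
    Module.End.mem_eigenspace_iff, hT, Module.End.mul_apply, Module.End.mul_apply, hWW, ← map_smul,
    hinj.eq_iff, ne_eq, ne_eq, map_eq_zero_iff W hinj]

theorem povmFail_hasEigenvector {n : ℕ} (ℓ : SchurLabel (n + 2)) (hs : ℓ.path (n + 2) ≠ n + 2) :
    Module.End.HasEigenvector (povmFail (n + 1))
      ((1 - 2 ^ n * lam (n + 1) (ℓ.path (n + 1)) (ℓ.path (n + 2)) *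
        uCoef (n + 1) (ℓ.path (n + 2)) / nu (n + 1) (ℓ.path (n + 1)) : ℝ) : ℂ) (schurState ℓ) := by
  -- By parity, `n + 2` is the only spin of `n + 2` qubits that `n` qubits cannot have.
  have hmem : ℓ.path (n + 2) ∈ spins n := by
    have := ℓ.isSpinPath.mem_spins
    simp only [spins, Finset.mem_filter, Finset.mem_range] at this ⊢
    omega
  rw [Module.End.hasEigenvector_iff, Module.End.mem_eigenspace_iff]
  refine ⟨?_, schurState_ne_zero ℓ⟩
  rw [schurState_eq, povmFail_schurVec ℓ.isSpinPath, if_pos hmem]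

theorem povmFail_hasEigenvector_top {n : ℕ} (ℓ : SchurLabel (n + 2))
    (hs : ℓ.path (n + 2) = n + 2) :
    Module.End.HasEigenvector (povmFail (n + 1)) 1 (schurState ℓ) := by
  have hmem : ℓ.path (n + 2) ∉ spins n := by
    simp only [spins, Finset.mem_filter, Finset.mem_range]
    omega
  rw [Module.End.hasEigenvector_iff, Module.End.mem_eigenspace_iff]
  refine ⟨?_, schurState_ne_zero ℓ⟩
  rw [schurState_eq, povmFail_schurVec ℓ.isSpinPath, if_neg hmem, sub_zero, Complex.ofReal_one]

end PBT

end

open PBT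

theorem mainTheorem3 (N : ℕ) (hN : 1 ≤ N) :
    -- the Schur states are an orthonormal basis with the spins given by their labels
    (Orthonormal ℂ (schurState : SchurLabel (N + 1) → QState (N + 1)) ∧
      Submodule.span ℂ (Set.range (schurState : SchurLabel (N + 1) → QState (N + 1))) = ⊤ ∧
      ∀ ℓ : SchurLabel (N + 1),
        (∀ i : Fin (N + 2),
          totalSpin (Finset.univ.filter fun q : Fin (N + 1) => (q : ℕ) < (i : ℕ)) (schurState ℓ) =
            ((ℓ.spin i : ℂ) / 2 * ((ℓ.spin i : ℂ) / 2 + 1)) • schurState ℓ) ∧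
        zSpin Finset.univ (schurState ℓ) = ((ℓ.z : ℂ) / 2) • schurState ℓ) ∧
    IsUnit (opO N) ∧
    -- `Π_N` annihilates the Schur states whose spin on the first `N - 1` qubits is not `s`
    (∀ ℓ : SchurLabel (N + 1), ℓ.kSpin ≠ ℓ.sSpin →
      Module.End.HasEigenvector (povm N ⟨N - 1, by omega⟩) 0 (schurState ℓ)) ∧
    -- the pairs of Schur states that differ only in the spin `j = s ∓ 1/2` of the ports
    (∀ ℓ₁ ℓ₂ : SchurLabel (N + 1), ∀ s : ℕ,
      (∀ i : Fin (N + 2), (i : ℕ) ≠ N → ℓ₁.spin i = ℓ₂.spin i) → ℓ₁.z = ℓ₂.z →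
      ℓ₁.kSpin = s → ℓ₁.sSpin = s → s = ℓ₁.jSpin + 1 → ℓ₂.jSpin = s + 1 →
      Module.End.HasEigenvector (povm N ⟨N - 1, by omega⟩) 0
        (((del N s / √(gam N s ^ 2 + del N s ^ 2) : ℝ) : ℂ) • schurState ℓ₁ -
          ((gam N s / √(gam N s ^ 2 + del N s ^ 2) : ℝ) : ℂ) • schurState ℓ₂) ∧
      Module.End.HasEigenvector (povm N ⟨N - 1, by omega⟩)
        ((uCoef N s * (gam N s ^ 2 + del N s ^ 2) : ℝ) : ℂ)
        (((gam N s / √(gam N s ^ 2 + del N s ^ 2) : ℝ) : ℂ) • schurState ℓ₁ +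
          ((del N s / √(gam N s ^ 2 + del N s ^ 2) : ℝ) : ℂ) • schurState ℓ₂)) ∧
    -- for `s = 0` only the state with `j = 1/2` exists
    (∀ ℓ : SchurLabel (N + 1), ℓ.kSpin = 0 → ℓ.sSpin = 0 →
      Module.End.HasEigenvector (povm N ⟨N - 1, by omega⟩)
        ((uCoef N 0 * (gam N 0 ^ 2 + del N 0 ^ 2) : ℝ) : ℂ) (schurState ℓ)) ∧
    (∀ s ∈ spins (N - 1), 0 < uCoef N s * (gam N s ^ 2 + del N s ^ 2)) ∧
    -- the other `Π_i` are conjugate to `Π_N` by exchanging two ports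
    (∀ i : Fin N,
      povm N i = swapOp i.castSucc (Fin.castSucc ⟨N - 1, by omega⟩) * povm N ⟨N - 1, by omega⟩ *
        swapOp i.castSucc (Fin.castSucc ⟨N - 1, by omega⟩) ∧
      ∀ (μ : ℂ) (v : QState (N + 1)),
        Module.End.HasEigenvector (povm N ⟨N - 1, by omega⟩) μ v ↔
          Module.End.HasEigenvector (povm N i) μ
            (swapOp i.castSucc (Fin.castSucc ⟨N - 1, by omega⟩) v)) ∧
    -- `Π_{N+1}` is diagonal in the Schur basis; `u(s)` is only defined for `s ≤ (N - 1) / 2`, and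
    -- `λ(j, s) = 0` for the states of maximal spin `s = (N + 1) / 2`
    (∀ ℓ : SchurLabel (N + 1), ℓ.sSpin ≠ N + 1 →
      Module.End.HasEigenvector (povmFail N)
        ((1 - 2 ^ (N - 1) * lam N ℓ.jSpin ℓ.sSpin * uCoef N ℓ.sSpin / nu N ℓ.jSpin : ℝ) : ℂ)
        (schurState ℓ)) ∧
    (∀ ℓ : SchurLabel (N + 1), ℓ.sSpin = N + 1 →
      Module.End.HasEigenvector (povmFail N) 1 (schurState ℓ)) := by
  -- Turns `N - 1` into `n`, so that port `A_N` becomes `Fin.last n` and there are `n + 2` qubits in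
  -- all.
  obtain ⟨n, rfl⟩ : ∃ n, N = n + 1 := ⟨N - 1, by omega⟩
  refine ⟨⟨orthonormal_schurState _, span_schurState _, fun ℓ =>
    ⟨totalSpin_initial_schurState ℓ, ?_⟩⟩, isUnit_opO _, fun ℓ h => ?_, ?_, fun ℓ hk hs => ?_,
    fun s _ => mul_pos (uCoef_pos hN s) (gam_sq_add_del_sq_pos _ _), fun i =>
    ⟨swapOp_conj_povm (n + 1) i (Fin.last n), fun μ v => ?_⟩, fun ℓ hs => ?_, fun ℓ hs => ?_⟩
  · rw [schurState_eq, zSpin_schurVec]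
  · rw [kSpin_eq, sSpin_eq] at h
    exact povm_last_hasEigenvector_of_ne ℓ h
  · intro ℓ₁ ℓ₂ s hp hz hk hs hj₁ hj₂
    rw [kSpin_eq] at hk
    rw [sSpin_eq] at hs
    rw [jSpin_eq] at hj₁ hj₂
    subst hj₁
    refine povm_last_hasEigenvector_pair ℓ₁ ℓ₂ (fun i hi hi' => ?_) hz hk hs rfl hj₂
    rw [ℓ₁.path_eq (by omega), ℓ₂.path_eq (by omega)]
    exact hp ⟨i, by omega⟩ hi'
  · rw [kSpin_eq] at hk
    rw [sSpin_eq] at hs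
    exact povm_last_hasEigenvector_zero ℓ hk hs
  · exact hasEigenvector_conj_iff (swapOp_mul_self _ _)
      (swapOp_conj_povm (n + 1) i (Fin.last n)) μ v
  · rw [sSpin_eq] at hs ⊢
    rw [jSpin_eq]
    exact povmFail_hasEigenvector ℓ hs
  · rw [sSpin_eq] at hs
    exact povmFail_hasEigenvector_top ℓ hs
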